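/- Conventions. A subset $C\subseteq\omega_1$ is a *club* if it is closed and unbounded, and $S\subseteq\omega_1$ is *stationary* if it meets every club. $\mathrm{MA}_{\omega_1}$ is the assertion that for every nonempty partial order satisfying the countable chain condition and every family of $\aleph_1$ dense subsets there is a filter meeting all of them. $(\dagger)$ is the assertion that if $S\subseteq\omega_1$ is stationary and $U_\alpha\subseteq\alpha$ is open for each $\alpha\in S$, then there is a club $E\subseteq\omega_1$ such that for stationarily many $\alpha\in S\cap E$ there is $\bar\alpha<\alpha$ with either $E\cap(\bar\alpha,\alpha)\subseteq U_\alpha$ or $E\cap(\bar\alpha,\alpha)\cap U_\alpha=\emptyset$. A linear order is *$\sigma$-scattered* if it is a union of countably many suborders none of which contains a copy of $(\mathbb{Q},\le)$. A *Baumgartner type* is a set $\{x_\alpha:\alpha\in S\}$, ordered lexicographically, where $S\subseteq\omega_1$ is stationary and $x_\alpha:\omega\to\alpha$ is strictly increasing with range cofinal in $\alpha$ for each $\alpha\in S$. For a linear order $L$ let $\hat L$ be its completion: the set of all initial segments of $L$ (including $\emptyset$ and $L$) that have no greatest element or have the form $\{y\in L:y<z\}$ with $z\in L$, ordered by inclusion,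 the segment $\{y\in L:y<z\}$ being identified with $z$. A set $Z$ *captures* $x\in L$ if there is $z\in Z\cap\hat L$ such that no element of $Z\cap L$ lies strictly between $z$ and $x$. Let $[\hat L]^{\omega}$ be the collection of countably infinite subsets of $\hat L$; a *club* in it is a subcollection that is cofinal under inclusion and closed under unions of increasing $\omega$-sequences. Let $\theta_L$ be the least regular cardinal such that all finite iterates of the power set operation applied to (the underlying set of) $L$ belong to $H(\theta_L)$, the collection of sets of hereditary cardinality less than $\theta_L$. The linear order $L$ is *amenable* if for every countable elementary submodel $M$ of $(H(\theta_L),\in)$ with $L$ (its underlying set and its order relation) an element of $M$, and every $x\in L$, there is a club $E\subseteq[\hat L]^{\omega}$ with $E\in M$ such that every element of $E\cap M$ captures $x$. **Theorem.** Assume $\mathrm{MA}_{\omega_1}$ and $(\dagger)$. If $L$ is an amenable linear order of cardinality $\aleph_1$ that is not $\sigma$-scattered, then $L$ contains an isomorphic copy of a Baumgartner type or of the reverse of a Baumgartner type. -/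

import Mathlib

open scoped Cardinal Ordinal

universe u v

namespace LinearOrderBasis

noncomputable section

/-! ### Club and stationary subsets of the first uncountable ordinal -/

/-- The first uncountable ordinal, as a type; it carries the order topology. -/
abbrev Omega1 : Type 1 := Set.Iio (ω₁ : Ordinal.{0})

/-- Closed unbounded subsets of `ω₁`. -/
def IsClub (C : Set Omega1) : Prop :=
  IsClosed C ∧ ∀ α : Omega1, ∃ β ∈ C, α ≤ β

/-- Stationary subsets of `ω₁`: those that meet every club. -/
def IsStationary (S : Set Omega1) : Prop :=
  ∀ C : Set Omega1, IsClub C → (S ∩ C).Nonempty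

/-! ### The two set-theoretic axioms -/

/-- The axiom `(†)`. The initial segment `Set.Iio α` is an open subset of `ω₁`, so a subset of it
is open in `α` exactly when it is open in `ω₁`. -/
def Dagger : Prop :=
  ∀ (S : Set Omega1) (U : Omega1 → Set Omega1), IsStationary S →
    (∀ α ∈ S, U α ⊆ Set.Iio α ∧ IsOpen (U α)) →
    ∃ E : Set Omega1, IsClub E ∧
      IsStationary {α | α ∈ S ∩ E ∧ ∃ a < α,
        E ∩ Set.Ioo a α ⊆ U α ∨ E ∩ Set.Ioo a α ∩ U α = ∅}

/-- The countable chain condition: every set of pairwise incompatible elements is countable. -/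
def CCC (P : Type v) [PartialOrder P] : Prop :=
  ∀ A : Set P, (∀ p ∈ A, ∀ q ∈ A, p ≠ q → ¬ ∃ r, r ≤ p ∧ r ≤ q) → A.Countable

/-- Martin's axiom `MA_{ω₁}`: for every nonempty ccc partial order and every family of `ℵ₁` dense
subsets there is a filter that meets all of them. -/
def MartinsAxiomOmega1 : Prop :=
  ∀ (P : Type v) [PartialOrder P] [Nonempty P], CCC P →
    ∀ D : Omega1 → Set P, (∀ ξ p, ∃ q ∈ D ξ, q ≤ p) →
      ∃ G : Order.PFilter P, ∀ ξ, ∃ p ∈ G, p ∈ D ξ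

/-! ### Scattered and `σ`-scattered orders -/

/-- A linear order is scattered if it contains no copy of the rationals. -/
def IsScattered (α : Type v) [LinearOrder α] : Prop :=
  IsEmpty (ℚ ↪o α)

/-- A linear order is `σ`-scattered if it is a union of countably many scattered suborders. -/
def IsSigmaScattered (α : Type v) [LinearOrder α] : Prop :=
  ∃ s : ℕ → Set α, (⋃ n, s n) = Set.univ ∧ ∀ n, IsScattered (s n)

/-! ### Baumgartner types -/

/-- `B` is a Baumgartner type: for some stationary `S ⊆ ω₁` and some strictly increasing cofinal
`ω`-sequences `x α` in `α` (for `α ∈ S`), it is the set `{x α : α ∈ S}`; the order on it is the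
lexicographic order of `Lex (ℕ → Omega1)`. -/
def IsBaumgartnerType (B : Set (Lex (ℕ → Omega1))) : Prop :=
  ∃ (S : Set Omega1) (x : Omega1 → ℕ → Omega1), IsStationary S ∧
    (∀ α ∈ S, StrictMono (x α) ∧ (∀ n, x α n < α) ∧ ∀ β < α, ∃ n, β < x α n) ∧
    B = (fun α => toLex (x α)) '' S

/-! ### The structures `H(θ)` and their elementary submodels -/

/-- `H(θ)`: the collection of all sets whose transitive closure has fewer than `θ` elements,
equivalently, which are included in a transitive set of cardinality less than `θ`. -/
def H (θ : Cardinal.{u}) : Set ZFSet.{u} :=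
  {x | ∃ t : ZFSet.{u}, t.IsTransitive ∧ x ⊆ t ∧ t.card < θ}

/-- The least regular cardinal `θ` such that all finite iterates of the power set operation
applied to `X` belong to `H(θ)`. -/
def theta (X : ZFSet.{u}) : Cardinal.{u} :=
  sInf {θ | θ.IsRegular ∧ ∀ n : ℕ, ZFSet.powerset^[n] X ∈ H θ}

/-- The cardinal `theta X` is indeed a regular cardinal with the required property. -/
theorem theta_spec (X : ZFSet.{u}) :
    (theta X).IsRegular ∧ ∀ n : ℕ, ZFSet.powerset^[n] X ∈ H (theta X) := by
  have hne : {θ : Cardinal.{u} | θ.IsRegular ∧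
      ∀ n : ℕ, ZFSet.powerset^[n] X ∈ H θ}.Nonempty := by
    let Y : ZFSet.{u} := ZFSet.iUnion fun n : ℕ => ZFSet.powerset^[n] X
    let t : ZFSet.{u} := ZFSet.vonNeumann Y.rank
    refine ⟨Order.succ (max ℵ₀ t.card), Cardinal.isRegular_succ (le_max_left _ _), fun n => ?_⟩
    refine ⟨t, ZFSet.isTransitive_vonNeumann _, ?_, ?_⟩
    · intro z hz
      exact ZFSet.subset_vonNeumann_self Y (ZFSet.mem_iUnion.2 ⟨n, hz⟩)
    · exact lt_of_le_of_lt (le_max_right _ _) (Order.lt_succ _)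
  exact csInf_mem hne

/-- The only relation symbol of the language of set theory. -/
inductive MemRel : ℕ → Type
  | mem : MemRel 2

/-- The first-order language of set theory. -/
def setLanguage : FirstOrder.Language := ⟨fun _ => Empty, MemRel⟩

/-- A collection of sets, as a structure with the true membership relation. -/
instance setStructure (A : Set ZFSet.{u}) : setLanguage.Structure A where
  funMap := fun f _ => f.elim
  RelMap := fun {_} r => match r with
    | MemRel.mem => fun v => (v 0).1 ∈ (v 1).1

/-! ### The completion of a linear order, and capturing

A linear order `L`, given as a type, is realised as a set through an injection `c` that
assigns sets to its points. -/

section Coded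

variable {L : Type u} [LinearOrder L] (c : L ↪ ZFSet.{u})

/-- The underlying set of `L`. -/
def carrierSet : ZFSet.{u} := ZFSet.range c

/-- The strict order of `L` as a set of ordered pairs. -/
def orderSet : ZFSet.{u} :=
  ZFSet.range fun p : {p : L × L // p.1 < p.2} => ZFSet.pair (c p.1.1) (c p.1.2)

/-- A subset of `L`, as a set. -/
def code (A : Set L) : ZFSet.{u} := ZFSet.range fun x : A => c x

/-- The (lower halves of) Dedekind cuts of `L`: the initial segments which either have no greatest
element or are of the form `{x | x < z}`, the latter being identified with the point `z`. The two
improper cuts are allowed. -/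
def IsCut (A : Set L) : Prop :=
  IsLowerSet A ∧ ((∃ z, A = Set.Iio z) ∨ ∀ a ∈ A, ∃ b ∈ A, a < b)

/-- The completion of `L`, as a set; it is ordered by inclusion. -/
def completionSet : ZFSet.{u} :=
  (carrierSet c).powerset.sep fun z => ∃ A : Set L, IsCut A ∧ z = code c A

/-- `Z` captures `x`: there is a `z ∈ Z` in the completion such that no point of `L` which is
(identified with) an element of `Z` is strictly between `z` and `x`. -/
def Captures (Z : ZFSet.{u}) (x : L) : Prop :=
  ∃ A : Set L, IsCut A ∧ code c A ∈ Z ∧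
    ∀ y : L, code c (Set.Iio y) ∈ Z →
      ¬ (A ⊂ Set.Iio y ∧ y < x) ∧ ¬ (x < y ∧ Set.Iio y ⊂ A)

end Coded

/-- `E` is a club in `[X]^ω`: a collection of countably infinite subsets of `X` that is cofinal
with respect to inclusion and closed under unions of increasing `ω`-sequences. -/
def IsClubCountable (X E : ZFSet.{u}) : Prop :=
  (∀ Z ∈ E, Z ⊆ X ∧ Z.card = ℵ₀) ∧
  (∀ Z : ZFSet.{u}, Z ⊆ X → Z.card = ℵ₀ → ∃ W ∈ E, Z ⊆ W) ∧
  (∀ f : ℕ → ZFSet.{u}, (∀ n, f n ∈ E) → (∀ n, f n ⊆ f (n + 1)) → ZFSet.iUnion f ∈ E)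

/-! ### Amenability -/

section Amenable

variable {L : Type u} [LinearOrder L] (c : L ↪ ZFSet.{u})

/-- The collection of all countable elementary submodels of `H(θ_L)` that have the linear order `L`
(its underlying set and its order relation) as an element. -/
def elementarySubmodels : Set (Set ZFSet.{u}) :=
  {M | M.Countable ∧
    (∃ N : setLanguage.ElementarySubstructure (H (theta (carrierSet c))),
      M = Subtype.val '' (N : Set (H (theta (carrierSet c))))) ∧
    carrierSet c ∈ M ∧ orderSet c ∈ M}

/-- `x` is internal to `M`: there is a club `E` of `[L̂]^ω` in `M` such that every element of
`E ∩ M` captures `x`. -/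
def IsInternal (M : Set ZFSet.{u}) (x : L) : Prop :=
  ∃ E ∈ M, IsClubCountable (completionSet c) E ∧ ∀ Z ∈ E, Z ∈ M → Captures c Z x

/-- The linear order that is realised as a set through `c` is amenable. -/
def IsAmenableVia : Prop :=
  ∀ M ∈ elementarySubmodels c, ∀ x : L, IsInternal c M x

/-- A linear order is amenable if it is amenable for some realisation as a set, that is, if it is
isomorphic to an amenable linearly ordered set. -/
def IsAmenable (L : Type u) [LinearOrder L] : Prop :=
  ∃ c : L ↪ ZFSet.{u}, IsAmenableVia c

end Amenable

end

end LinearOrderBasis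

/-!
Let `M ξ`, for `ξ < ω₁`, be a continuous chain of countable elementary submodels, and let `N ξ` be
the set of cuts of `L` that belong to `M ξ`. A point `x` of `L` has a neighbour at level `ξ` if the
elements of `N ξ` below `x` have a maximum or those above `x` have a minimum. If all points had
neighbours at all levels in a club, the finitely many neighbours met on the way to each point would
divide `L` into countably many scattered pieces. Hence for stationarily many `δ` there is a point
`x δ` without a neighbour at level `δ`. By amenability it does have neighbours at all large levels
below `δ`, and by `(†)` these lie, for stationarily many `δ`, on the same side for all large `ξ < δ`
in a club. The levels at which this best approximation to `x δ` from one side changes form a ladder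
in `δ`. Uniformizing a colouring that codes the approximations makes the ladders coherent on a
stationary set: where two of them agree, so do the approximations. The points `x δ` are then ordered
by the first difference of the ladders.
-/

namespace LinearOrderBasis

open Set Order

/-! ### Clubs and stationary sets -/

namespace Omega1

theorem countable_Iio (a : Omega1) : (Iio a).Countable := by
  have h : (Iio a.1).Countable := by
    rw [← Cardinal.le_aleph0_iff_set_countable, Cardinal.mk_Iio_ordinal, Cardinal.lift_le_aleph0,
      ← lt_succ_iff, Cardinal.succ_aleph0, ← Cardinal.lt_ord, Cardinal.ord_aleph]
    exact a.2
  exact h.preimage Subtype.val_injective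

theorem exists_forall_lt {s : Set Omega1} (hs : s.Countable) : ∃ b, ∀ a ∈ s, a < b := by
  have : Countable s := hs
  have h : ⨆ a : s, succ a.1.1 < ω₁ :=
    Ordinal.iSup_lt_omega_one fun a => (Cardinal.isSuccLimit_omega 1).succ_lt a.1.2
  refine ⟨⟨_, h⟩, fun a ha => Subtype.coe_lt_coe.1 ((lt_succ a.1).trans_le ?_)⟩
  exact Ordinal.le_iSup (fun a : s => succ a.1.1) ⟨a, ha⟩

instance : NoMaxOrder Omega1 where
  exists_gt a := by simpa using exists_forall_lt (countable_singleton a)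

instance : Nonempty Omega1 := ⟨⟨0, Ordinal.omega_pos 1⟩⟩

theorem countable_Iic (a : Omega1) : (Iic a).Countable := by
  rw [← Iio_succ]
  exact countable_Iio _

theorem exists_isLUB {s : Set Omega1} (hs : s.Countable) : ∃ b, IsLUB s b := by
  obtain ⟨b, hb⟩ := exists_forall_lt hs
  have h : (upperBounds s).Nonempty := ⟨b, fun a ha => (hb a ha).le⟩
  exact ⟨_, wellFounded_lt.min_mem _ h, fun _ hc => wellFounded_lt.min_le hc⟩

end Omega1

theorem IsClub.exists_gt {C : Set Omega1} (hC : IsClub C) (a : Omega1) : ∃ b ∈ C, a < b := by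
  obtain ⟨b, hb, h⟩ := hC.2 (succ a)
  exact ⟨b, hb, (lt_succ a).trans_le h⟩

theorem IsClub.mem_of_forall_lt {C : Set Omega1} (hC : IsClub C) {δ : Omega1} (hδ : IsSuccLimit δ)
    (h : ∀ a < δ, (C ∩ Ioo a δ).Nonempty) : δ ∈ C :=
  (isClosed_iff_derivedSet_subset C).1 hC.1 (SuccOrder.accPt_principal.2 ⟨hδ.not_isMin, h⟩)

theorem isClub_closurePoints (h : Omega1 → Omega1) :
    IsClub {δ | IsSuccLimit δ ∧ ∀ ξ < δ, h ξ < δ} := by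
  constructor
  · refine (isClosed_iff_derivedSet_subset _).2 fun δ hδ => ⟨hδ.isSuccLimit, fun ξ hξ => ?_⟩
    obtain ⟨b, hb, hξb, hbδ⟩ := (SuccOrder.accPt_principal.1 hδ).2 ξ hξ
    exact (hb.2 ξ hξb).trans hbδ
  · intro α
    have hg : ∀ a : Omega1, ∃ b, a < b ∧ ∀ ξ ≤ a, h ξ < b := fun a => by
      obtain ⟨b, hb⟩ := Omega1.exists_forall_lt (((Omega1.countable_Iic a).image h).insert a)
      exact ⟨b, hb a (mem_insert _ _), fun ξ hξ => hb _ (mem_insert_of_mem _ ⟨ξ, hξ, rfl⟩)⟩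
    choose g hlt hhg using hg
    obtain ⟨δ, hδ⟩ := Omega1.exists_isLUB (countable_range fun n : ℕ => g^[n] α)
    have hle (n : ℕ) : g^[n] α ≤ δ := hδ.1 ⟨n, rfl⟩
    have hcofinal {ξ : Omega1} (hξ : ξ < δ) : ∃ n : ℕ, ξ < g^[n] α := by
      simpa using (lt_isLUB_iff hδ).1 hξ
    refine ⟨δ, ⟨⟨fun hmin => ?_, fun ξ hξ => ?_⟩, fun ξ hξ => ?_⟩, hle 0⟩
    · exact (hmin (hle 0)).not_gt ((hlt α).trans_le (hle 1))
    · obtain ⟨n, hn⟩ := hcofinal hξ.lt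
      refine hξ.2 hn ((hlt _).trans_le ?_)
      simpa only [Function.iterate_succ_apply'] using hle (n + 1)
    · obtain ⟨n, hn⟩ := hcofinal hξ
      refine (hhg _ ξ hn.le).trans_le ?_
      simpa only [Function.iterate_succ_apply'] using hle (n + 1)

theorem exists_isClub_forall_mem {X : Type*} (C : X → Set Omega1) (hC : ∀ v, IsClub (C v))
    (Q : Omega1 → Set X) (hQ : ∀ ξ, (Q ξ).Countable) :
    ∃ D, IsClub D ∧ ∀ δ ∈ D, IsSuccLimit δ ∧ ∀ ξ < δ, ∀ v ∈ Q ξ, δ ∈ C v := by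
  choose next hnext hlt using fun v => (hC v).exists_gt
  have hh : ∀ a : Omega1, ∃ b, ∀ ξ ≤ a, ∀ v ∈ Q ξ, next v a < b := fun a => by
    obtain ⟨b, hb⟩ := Omega1.exists_forall_lt
      (((Omega1.countable_Iic a).biUnion fun ξ _ => hQ ξ).image fun v => next v a)
    exact ⟨b, fun ξ hξ v hv => hb _ ⟨v, mem_biUnion hξ hv, rfl⟩⟩
  choose h hh using hh
  refine ⟨_, isClub_closurePoints h, fun δ hδ => ⟨hδ.1, fun ξ hξ v hv => ?_⟩⟩
  refine (hC v).mem_of_forall_lt hδ.1 fun a ha => ?_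
  exact ⟨next v (max a ξ), hnext _ _, (le_max_left _ _).trans_lt (hlt _ _),
    (hh _ ξ (le_max_right _ _) v hv).trans (hδ.2 _ (max_lt ha hξ))⟩

theorem IsClub.derivedSet {E : Set Omega1} (hE : IsClub E) : IsClub (derivedSet E) := by
  refine ⟨isClosed_derivedSet E, fun α => ?_⟩
  choose g hg hlt using hE.exists_gt
  obtain ⟨δ, ⟨hδ, hgδ⟩, hαδ⟩ := (isClub_closurePoints g).2 α
  exact ⟨δ, SuccOrder.accPt_principal.2 ⟨hδ.not_isMin, fun a ha => ⟨g a, hg a, hlt a, hgδ a ha⟩⟩,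
    hαδ⟩

theorem IsClub.derivedSet_subset {E : Set Omega1} (hE : IsClub E) : _root_.derivedSet E ⊆ E :=
  (isClosed_iff_derivedSet_subset E).1 hE.1

theorem isClub_Ioi (a : Omega1) : IsClub (Ioi a) := by
  refine ⟨(isClosed_iff_derivedSet_subset _).2 fun δ hδ => ?_, fun b => ?_⟩
  · obtain ⟨⟨c, hc⟩, h⟩ := (SuccOrder.accPt_principal.1 hδ).imp_left not_isMin_iff.1
    obtain ⟨b, hab, -, hbδ⟩ := h c hc
    exact (mem_Ioi.1 hab).trans hbδ
  · exact ⟨succ (max a b), (le_max_left a b).trans_lt (lt_succ _),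
      ((le_max_right a b).trans_lt (lt_succ _)).le⟩

theorem isClub_isSuccLimit : IsClub {δ : Omega1 | IsSuccLimit δ} := by
  simpa using isClub_closurePoints id

theorem IsStationary.mono {S T : Set Omega1} (hS : IsStationary S) (h : S ⊆ T) : IsStationary T :=
  fun C hC => (hS C hC).mono (inter_subset_inter_left _ h)

theorem IsStationary.inter_isClub {S C : Set Omega1} (hS : IsStationary S) (hC : IsClub C) :
    IsStationary (S ∩ C) := by
  intro C' hC'
  obtain ⟨D, hD, h⟩ := exists_isClub_forall_mem (fun b : Bool => if b then C else C')
    (by simp [hC, hC']) (fun _ => univ) fun _ => to_countable _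
  obtain ⟨δ, hδS, hδD⟩ := hS D hD
  obtain ⟨hδ, hδC⟩ := h δ hδD
  obtain ⟨ξ, hξ⟩ := hδ.nonempty_Iio
  exact ⟨δ, ⟨hδS, by simpa using hδC ξ hξ true⟩, by simpa using hδC ξ hξ false⟩

theorem IsStationary.exists_of_forall_exists_lt {X : Type*} {S : Set Omega1} (hS : IsStationary S)
    {p : Omega1 → X → Prop} (Q : Omega1 → Set X) (hQ : ∀ ξ, (Q ξ).Countable)
    (h : ∀ δ ∈ S, ∃ ξ < δ, ∃ v ∈ Q ξ, p δ v) : ∃ v, IsStationary {δ ∈ S | p δ v} := by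
  by_contra! hne
  have hC : ∀ v, ∃ C, IsClub C ∧ {δ ∈ S | p δ v} ∩ C = ∅ := fun v => by
    simpa [IsStationary, not_nonempty_iff_eq_empty] using hne v
  choose C hC hempty using hC
  obtain ⟨D, hD, hDC⟩ := exists_isClub_forall_mem C hC Q hQ
  obtain ⟨δ, hδ, hδD⟩ := hS D hD
  obtain ⟨ξ, hξ, v, hv, hp⟩ := h δ hδ
  exact (hempty v).le ⟨⟨hδ, hp⟩, (hDC δ hδD).2 ξ hξ v hv⟩

theorem IsStationary.exists_bound {S : Set Omega1} (hS : IsStationary S)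
    {p : Omega1 → Omega1 → Prop} (hp : ∀ δ ∈ S, ∃ a < δ, p δ a) :
    ∃ a, IsStationary {δ ∈ S | p δ a} :=
  hS.exists_of_forall_exists_lt (fun ξ => {ξ}) (fun ξ => countable_singleton ξ) fun δ hδ => by
    simpa using hp δ hδ

theorem IsStationary.exists_of_countable {X : Type*} [Countable X] {S : Set Omega1}
    (hS : IsStationary S) {p : Omega1 → X → Prop} (hp : ∀ δ ∈ S, ∃ v, p δ v) :
    ∃ v, IsStationary {δ ∈ S | p δ v} := by
  obtain ⟨v, hv⟩ := (hS.inter_isClub isClub_isSuccLimit).exists_of_forall_exists_lt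
    (p := p) (fun _ => univ) (fun _ => to_countable _) fun δ hδ => by
      obtain ⟨ξ, hξ⟩ := IsSuccLimit.nonempty_Iio hδ.2
      exact ⟨ξ, hξ, by simpa using hp δ hδ.1⟩
  exact ⟨v, hv.mono fun δ hδ => ⟨hδ.1.1, hδ.2⟩⟩

theorem Dagger.exists_dichotomy (hDagger : Dagger) {S : Set Omega1} (hS : IsStationary S)
    (U : Omega1 → Set Omega1) (hU : ∀ δ ∈ S, U δ ⊆ Iio δ ∧ IsOpen (U δ)) :
    ∃ E, IsClub E ∧ ∃ b, IsStationary {δ ∈ S | E ∩ Ioo b δ ⊆ U δ} ∨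
      IsStationary {δ ∈ S | Disjoint (E ∩ Ioo b δ) (U δ)} := by
  obtain ⟨E, hE, hSE⟩ := hDagger S U hS hU
  obtain ⟨b, hb⟩ := hSE.exists_bound fun δ hδ => hδ.2
  obtain ⟨v, hv⟩ := hb.exists_of_countable
    (p := fun δ (v : Bool) => if v then E ∩ Ioo b δ ⊆ U δ else E ∩ Ioo b δ ∩ U δ = ∅) fun δ hδ => by
      simpa [or_comm] using hδ.2
  refine ⟨E, hE, b, ?_⟩
  cases v with
  | true => exact .inl (hv.mono fun δ hδ => ⟨hδ.1.1.1.1, by simpa using hδ.2⟩)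
  | false => exact .inr (hv.mono fun δ hδ =>
      ⟨hδ.1.1.1.1, disjoint_iff_inter_eq_empty.2 (by simpa using hδ.2)⟩)

/-! ### Filtrations -/

/-- The least element of the club `E` that is at least `ξ`. -/
noncomputable def IsClub.next {E : Set Omega1} (hE : IsClub E) (ξ : Omega1) : Omega1 :=
  wellFounded_lt.min {b | b ∈ E ∧ ξ ≤ b} (hE.2 ξ)

section Next

variable {E : Set Omega1} (hE : IsClub E) {ξ b : Omega1}

theorem IsClub.next_mem (ξ : Omega1) : hE.next ξ ∈ E :=
  (wellFounded_lt.min_mem {b | b ∈ E ∧ ξ ≤ b} (hE.2 ξ)).1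

theorem IsClub.le_next (ξ : Omega1) : ξ ≤ hE.next ξ :=
  (wellFounded_lt.min_mem {b | b ∈ E ∧ ξ ≤ b} (hE.2 ξ)).2

theorem IsClub.next_le (hb : b ∈ E) (h : ξ ≤ b) : hE.next ξ ≤ b :=
  wellFounded_lt.min_le (s := {b | b ∈ E ∧ ξ ≤ b}) ⟨hb, h⟩

theorem IsClub.next_eq (hξ : ξ ∈ E) : hE.next ξ = ξ :=
  (hE.next_le hξ le_rfl).antisymm (hE.le_next ξ)

theorem IsClub.next_mono : Monotone hE.next := fun _ b h =>
  hE.next_le (hE.next_mem b) (h.trans (hE.le_next b))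

end Next

/-- A filtration is an increasing sequence of countable sets, of length `ω₁`, that is continuous
at limits. The sets are not required to be strictly increasing or to cover the whole type. -/
structure IsFiltration {W : Type*} (N : Omega1 → Set W) : Prop where
  mono : Monotone N
  countable : ∀ ξ, (N ξ).Countable
  exists_lt : ∀ {ξ}, IsSuccLimit ξ → ∀ {w}, w ∈ N ξ → ∃ η < ξ, w ∈ N η

namespace IsFiltration

variable {W : Type*} {N : Omega1 → Set W}

theorem preimage {V : Type*} (hN : IsFiltration N) {f : V → W} (hf : Function.Injective f) :
    IsFiltration fun ξ => f ⁻¹' N ξ where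
  mono _ _ h := preimage_mono (hN.mono h)
  countable ξ := (hN.countable ξ).preimage hf
  exists_lt hξ _ hw := hN.exists_lt hξ hw

theorem image {V : Type*} (hN : IsFiltration N) (f : W → V) : IsFiltration fun ξ => f '' N ξ where
  mono _ _ h := image_mono (hN.mono h)
  countable ξ := (hN.countable ξ).image f
  exists_lt := by
    rintro ξ hξ _ ⟨w, hw, rfl⟩
    obtain ⟨η, hη, hwη⟩ := hN.exists_lt hξ hw
    exact ⟨η, hη, mem_image_of_mem f hwη⟩

theorem comp_next (hN : IsFiltration N) {E : Set Omega1} (hE : IsClub E) :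
    IsFiltration fun ξ => N (hE.next ξ) where
  mono := hN.mono.comp hE.next_mono
  countable _ := hN.countable _
  exists_lt := by
    intro ξ hξ w hw
    by_cases hacc : ∀ a < ξ, (E ∩ Ioo a ξ).Nonempty
    · rw [hE.next_eq (hE.mem_of_forall_lt hξ hacc)] at hw
      obtain ⟨η, hη, hw⟩ := hN.exists_lt hξ hw
      exact ⟨η, hη, hN.mono (hE.le_next η) hw⟩
    · push Not at hacc
      obtain ⟨a, ha, hempty⟩ := hacc
      have hle : hE.next ξ ≤ hE.next (succ a) := hE.next_le (hE.next_mem _) <| not_lt.1 fun h =>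
        hempty.le ⟨hE.next_mem _, (lt_succ a).trans_le (hE.le_next _), h⟩
      exact ⟨succ a, hξ.succ_lt ha, hN.mono hle hw⟩

end IsFiltration

/-! ### Uniformization of ladder system colourings -/

/-- A ladder system on `S`: a strictly increasing cofinal `ω`-sequence in each `δ ∈ S`. -/
structure IsLadderSystem (S : Set Omega1) (lad : Omega1 → ℕ → Omega1) : Prop where
  strictMono : ∀ {δ}, δ ∈ S → StrictMono (lad δ)
  lt : ∀ {δ}, δ ∈ S → ∀ n, lad δ n < δ
  exists_lt : ∀ {δ}, δ ∈ S → ∀ β < δ, ∃ n, β < lad δ n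

/-- The uniformization principle that Martin's axiom is used for: any colouring of the rungs of the
ladders of a ladder system agrees on each single ladder, up to finitely many rungs, with a colouring
of `ω₁`. -/
def LadderUniformization : Prop :=
  ∀ (S : Set Omega1) (lad : Omega1 → ℕ → Omega1), IsLadderSystem S lad → ∀ c : Omega1 → ℕ → ℕ,
    ∃ f : Omega1 → ℕ, ∀ δ ∈ S, ∀ᶠ m in Filter.atTop, f (lad δ m) = c δ m

theorem IsLadderSystem.finite_le {S : Set Omega1} {lad : Omega1 → ℕ → Omega1}
    (hlad : IsLadderSystem S lad) {δ β : Omega1} (hδ : δ ∈ S) (hβ : β < δ) :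
    {n | lad δ n ≤ β}.Finite := by
  obtain ⟨n, hn⟩ := hlad.exists_lt hδ β hβ
  exact (finite_Iio n).subset fun m hm => (hlad.strictMono hδ).lt_iff_lt.1 (hm.trans_lt hn)

theorem IsLadderSystem.eventually_notMem_range {S : Set Omega1} {lad : Omega1 → ℕ → Omega1}
    (hlad : IsLadderSystem S lad) {δ γ : Omega1} (hδ : δ ∈ S) (hγ : γ ∈ S) (h : δ ≠ γ) :
    ∀ᶠ m in Filter.atTop, lad δ m ∉ range (lad γ) := by
  rw [← Nat.cofinite_eq_atTop, Filter.eventually_cofinite]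
  simp only [not_not]
  rcases h.lt_or_gt with h | h
  · refine (((hlad.finite_le hγ h).image (lad γ)).preimage
      (hlad.strictMono hδ).injective.injOn).subset ?_
    rintro m ⟨k, hk⟩
    exact ⟨k, (hk.trans_lt (hlad.lt hδ m)).le, hk⟩
  · refine (hlad.finite_le hδ h).subset ?_
    rintro m ⟨k, hk⟩
    exact (hk.symm.trans_lt (hlad.lt hγ k)).le

/-- Two promises are compatible. The promise `(δ, n)` is that a function on `ω₁` follows the
colouring `c δ` of the ladder `lad δ` from the rung of index `n` on. -/
def Compatible (lad : Omega1 → ℕ → Omega1) (c : Omega1 → ℕ → ℕ) (p q : Omega1 × ℕ) : Prop :=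
  ∀ m k, p.2 ≤ m → q.2 ≤ k → lad p.1 m = lad q.1 k → c p.1 m = c q.1 k

theorem exists_root_of_card {X : Type*} {A : Set (Finset X)} (hA : ¬ A.Countable) {k : ℕ}
    (hk : ∀ u ∈ A, u.card = k) :
    ∃ r : Finset X, ¬ {u ∈ A | r ⊆ u}.Countable ∧
      ∀ p ∉ r, {u ∈ A | r ⊆ u ∧ p ∈ u}.Countable := by
  classical
  by_contra! hroot
  have hextend : ∀ j : ℕ, ∃ r : Finset X, r.card = j ∧ ¬ {u ∈ A | r ⊆ u}.Countable := fun j => by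
    induction j with
    | zero => exact ⟨∅, rfl, by simpa using hA⟩
    | succ j ih =>
      obtain ⟨r, rfl, hu⟩ := ih
      obtain ⟨p, hp, hup⟩ := hroot r hu
      refine ⟨insert p r, Finset.card_insert_of_notMem hp, fun hc => hup (hc.mono fun u hu => ?_)⟩
      exact ⟨hu.1, Finset.insert_subset hu.2.2 hu.2.1⟩
  obtain ⟨r, hr, hu⟩ := hextend (k + 1)
  refine hu (countable_empty.mono ?_)
  rintro u ⟨huA, hru⟩
  have := Finset.card_le_card hru
  rw [hk u huA] at this
  omega

theorem exists_root {X : Type*} {A : Set (Finset X)} (hA : ¬ A.Countable) :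
    ∃ r : Finset X, ∀ P : Set X, P.Countable → ∃ u ∈ A, r ⊂ u ∧ ∀ p ∈ u, p ∈ P → p ∈ r := by
  obtain ⟨k, hk⟩ : ∃ k, ¬ {u ∈ A | u.card = k}.Countable := by
    by_contra! h
    refine hA ((countable_iUnion h).mono fun u hu => ?_)
    exact mem_iUnion.2 ⟨u.card, hu, rfl⟩
  obtain ⟨r, hr, hmax⟩ := exists_root_of_card hk fun u hu => hu.2
  refine ⟨r, fun P hP => ?_⟩
  have hbad : (insert r (⋃ p ∈ P \ ↑r, {u ∈ A | u.card = k ∧ r ⊆ u ∧ p ∈ u})).Countable := by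
    refine ((hP.mono sdiff_subset).biUnion fun p hp => (hmax p hp.2).mono ?_).insert r
    exact fun u hu => ⟨⟨hu.1, hu.2.1⟩, hu.2.2⟩
  obtain ⟨u, ⟨⟨huA, huk⟩, hru⟩, hu⟩ := not_subset.1 fun h => hr (hbad.mono h)
  rw [mem_insert_iff, not_or] at hu
  refine ⟨u, huA, hru.ssubset_of_ne (Ne.symm hu.1), fun p hpu hpP => ?_⟩
  by_contra hpr
  exact hu.2 (mem_iUnion₂.2 ⟨p, ⟨hpP, hpr⟩, huA, huk, hru, hpu⟩)

theorem exists_isStationary_eq_of_finite {X : Type*} [Countable X] (t : Omega1 → Set (Omega1 × X))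
    (hfin : ∀ δ, (t δ).Finite) (ht : ∀ δ, ∀ x ∈ t δ, x.1 < δ) :
    ∃ T, IsStationary {δ | t δ = T} := by
  have hlim : IsStationary {δ : Omega1 | IsSuccLimit δ} := fun C hC => by
    obtain ⟨δ, hδ⟩ := hC.derivedSet.2 (Classical.arbitrary _)
    exact ⟨δ, hδ.1.isSuccLimit, hC.derivedSet_subset hδ.1⟩
  obtain ⟨T, hT⟩ := hlim.exists_of_forall_exists_lt (p := fun δ T => t δ = T)
    (fun ξ => {s | s.Finite ∧ s ⊆ Iic ξ ×ˢ univ})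
    (fun ξ => countable_ofPred_finite_subset ((Omega1.countable_Iic ξ).prod countable_univ))
    fun δ hδ => by
      obtain ⟨a, ha⟩ := IsSuccLimit.nonempty_Iio hδ
      obtain ⟨b, hb, hmax⟩ := exists_max_image (insert a (Prod.fst '' t δ)) id
        (((hfin δ).image _).insert a) (insert_nonempty _ _)
      refine ⟨b, ?_, _, ⟨hfin δ, fun x hx => ⟨hmax _ (.inr ⟨x, hx, rfl⟩), trivial⟩⟩, rfl⟩
      rcases hb with rfl | ⟨x, hx, rfl⟩
      exacts [ha, ht δ x hx]
  exact ⟨T, hT.mono fun δ hδ => hδ.2⟩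

section Compatible

variable {S : Set Omega1} {lad : Omega1 → ℕ → Omega1} {c : Omega1 → ℕ → ℕ}

instance : Std.Symm (Compatible lad c) :=
  ⟨fun _ _ h m k hm hk he => (h k m hk hm he.symm).symm⟩

theorem IsLadderSystem.compatible (hlad : IsLadderSystem S lad) {U : Set (Omega1 × ℕ)}
    (hUS : ∀ p ∈ U, p.1 ∈ S) (hU : U.Pairwise (Compatible lad c)) {p q : Omega1 × ℕ} (hp : p ∈ U)
    (hq : q ∈ U) : Compatible lad c p q := by
  rcases eq_or_ne p q with rfl | hpq
  · exact fun m k _ _ h => congrArg _ ((hlad.strictMono (hUS p hp)).injective h)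
  · exact hU hp hq hpq

theorem IsLadderSystem.exists_uniformizing (hlad : IsLadderSystem S lad) {U : Set (Omega1 × ℕ)}
    (hUS : ∀ p ∈ U, p.1 ∈ S) (hU : U.Pairwise (Compatible lad c)) :
    ∃ f : Omega1 → ℕ, ∀ p ∈ U, ∀ m ≥ p.2, f (lad p.1 m) = c p.1 m := by
  let rung : (Omega1 × ℕ) × ℕ → Omega1 := fun x => lad x.1.1 x.2
  let D : Set ((Omega1 × ℕ) × ℕ) := {x | x.1 ∈ U ∧ x.1.2 ≤ x.2}
  let g := Function.invFunOn rung D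
  refine ⟨fun ξ => c (g ξ).1.1 (g ξ).2, fun p hp m hm => ?_⟩
  have hmem : ∃ x ∈ D, rung x = lad p.1 m := ⟨(p, m), ⟨hp, hm⟩, rfl⟩
  have hg : g (lad p.1 m) ∈ D := Function.invFunOn_mem hmem
  exact hlad.compatible hUS hU hg.1 hp _ _ hg.2 hm (Function.invFunOn_eq hmem)

/- The rungs below `α` followed by the promises of `v α`, and their colours, form a finite set. By
pressing down it is the same set for some `α` and some large `β`, and then every rung of `v β` that
might clash with `v α` carries a colour that is already taken there. -/
theorem IsLadderSystem.exists_forall_compatible (hlad : IsLadderSystem S lad)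
    (v : Omega1 → Set (Omega1 × ℕ)) (hfin : ∀ α, (v α).Finite) (hvS : ∀ α, ∀ p ∈ v α, p.1 ∈ S)
    (hv : ∀ α, (v α).Pairwise (Compatible lad c)) (hlt : ∀ α, ∀ p ∈ v α, α < p.1) :
    ∃ α β, (∀ p ∈ v α, p.1 < β) ∧ ∀ p ∈ v α, ∀ q ∈ v β, Compatible lad c p q := by
  let t : Omega1 → Set (Omega1 × ℕ) := fun α =>
    ⋃ p ∈ v α, (fun m => (lad p.1 m, c p.1 m)) '' {m | p.2 ≤ m ∧ lad p.1 m < α}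
  have htfin (α : Omega1) : (t α).Finite := (hfin α).biUnion fun p hp =>
    ((hlad.finite_le (hvS α p hp) (hlt α p hp)).subset fun m hm => hm.2.le).image _
  obtain ⟨T, hT⟩ := exists_isStationary_eq_of_finite t htfin fun α x hx => by
    obtain ⟨p, -, m, hm, rfl⟩ := mem_iUnion₂.1 hx
    exact hm.2
  obtain ⟨α, hα, -⟩ := hT _ (isClub_Ioi (Classical.arbitrary _))
  obtain ⟨b, hb⟩ := Omega1.exists_forall_lt ((hfin α).image Prod.fst).countable
  obtain ⟨β, hβ, hbβ⟩ := hT _ (isClub_Ioi b)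
  have hαβ : ∀ p ∈ v α, p.1 < β := fun p hp => (hb _ ⟨p, hp, rfl⟩).trans hbβ
  refine ⟨α, β, hαβ, fun p hp q hq m k hm hk h => ?_⟩
  have hkβ : lad q.1 k < β := h ▸ (hlad.lt (hvS α p hp) m).trans (hαβ p hp)
  have hmem : (lad q.1 k, c q.1 k) ∈ t α :=
    (hβ.trans hα.symm : t β = t α) ▸ mem_biUnion hq ⟨k, ⟨hk, hkβ⟩, rfl⟩
  obtain ⟨q', hq', k', hk', he⟩ := mem_iUnion₂.1 hmem
  rw [Prod.mk.injEq] at he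
  rw [← he.2]
  exact hlad.compatible (hvS α) (hv α) hp hq' m k' hm hk'.1 (h.trans he.1.symm)

theorem IsLadderSystem.exists_pairwise_union (hlad : IsLadderSystem S lad)
    {A : Set (Finset (Omega1 × ℕ))} (hA : ¬ A.Countable) (hS : ∀ u ∈ A, ∀ p ∈ u, p.1 ∈ S)
    (hc : ∀ u ∈ A, (u : Set (Omega1 × ℕ)).Pairwise (Compatible lad c)) :
    ∃ u ∈ A, ∃ v ∈ A, u ≠ v ∧
      ((u : Set (Omega1 × ℕ)) ∪ v).Pairwise (Compatible lad c) := by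
  obtain ⟨r, hr⟩ := exists_root hA
  choose w hwA hrw hw using fun α : Omega1 =>
    hr (Iic α ×ˢ univ) ((Omega1.countable_Iic α).prod countable_univ)
  obtain ⟨α, β, hαβ, hcross⟩ := hlad.exists_forall_compatible (c := c) (fun α => ↑(w α) \ ↑r)
    (fun α => (w α).finite_toSet.subset sdiff_subset) (fun α p hp => hS _ (hwA α) p hp.1)
    (fun α => (hc _ (hwA α)).mono sdiff_subset)
    fun α p hp => not_le.1 fun h => hp.2 (hw α p hp.1 ⟨h, trivial⟩)
  refine ⟨w α, hwA α, w β, hwA β, fun heq => ?_, ?_⟩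
  · obtain ⟨p, hp, hpr⟩ := Finset.exists_of_ssubset (hrw α)
    exact hpr (hw β p (heq ▸ hp) ⟨(hαβ p ⟨hp, hpr⟩).le, trivial⟩)
  · refine pairwise_union_of_symm.2
      ⟨hc _ (hwA α), hc _ (hwA β), fun p hp q hq hpq => ?_⟩
    by_cases hpr : p ∈ r
    · exact hc _ (hwA β) ((hrw β).1 hpr) hq hpq
    by_cases hqr : q ∈ r
    · exact hc _ (hwA α) hp ((hrw α).1 hqr) hpq
    exact hcross p ⟨hp, hpr⟩ q ⟨hq, hqr⟩

end Compatible

/-- The forcing conditions for uniformizing the colouring `c`: finite sets of pairwise compatible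
promises, a larger set being a stronger (that is, smaller) condition. -/
def Condition (S : Set Omega1) (lad : Omega1 → ℕ → Omega1) (c : Omega1 → ℕ → ℕ) : Type 1 :=
  {u : Finset (Omega1 × ℕ) //
    (∀ p ∈ u, p.1 ∈ S) ∧ (u : Set (Omega1 × ℕ)).Pairwise (Compatible lad c)}

namespace Condition

variable {S : Set Omega1} {lad : Omega1 → ℕ → Omega1} {c : Omega1 → ℕ → ℕ}

instance : PartialOrder (Condition S lad c) :=
  PartialOrder.lift (fun u => OrderDual.toDual u.1)
    (OrderDual.toDual.injective.comp Subtype.val_injective)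

instance : Nonempty (Condition S lad c) := ⟨⟨∅, by simp, by simp⟩⟩

instance : Small.{u} (Condition S lad c) := by
  have : Small.{u} Omega1 :=
    small_of_injective ((equivShrink.{0} Omega1).trans Equiv.ulift.{u}.symm).injective
  have : Small.{u} (Finset (Omega1 × ℕ)) :=
    small_of_injective (β := Set (Omega1 × ℕ)) Finset.coe_injective
  exact small_subtype.{u} _ _

theorem ccc (hlad : IsLadderSystem S lad) : CCC (Condition S lad c) := by
  classical
  intro A hA
  by_contra hunc
  obtain ⟨_, ⟨u, hu, rfl⟩, _, ⟨v, hv, rfl⟩, hne, huv⟩ :=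
    hlad.exists_pairwise_union (c := c) (A := Subtype.val '' A)
      (fun h => hunc (countable_of_injective_of_countable_image Subtype.val_injective.injOn h))
      (by rintro _ ⟨u, -, rfl⟩; exact u.2.1) (by rintro _ ⟨u, -, rfl⟩; exact u.2.2)
  refine hA u hu v hv (ne_of_apply_ne _ hne) ⟨⟨u.1 ∪ v.1, fun p hp => ?_, by simpa using huv⟩,
    Finset.subset_union_left, Finset.subset_union_right⟩
  exact (Finset.mem_union.1 hp).elim (u.2.1 p) (v.2.1 p)

theorem exists_le_mem (hlad : IsLadderSystem S lad) {δ : Omega1} (hδ : δ ∈ S)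
    (u : Condition S lad c) : ∃ v ≤ u, ∃ n, (δ, n) ∈ v.1 := by
  classical
  by_cases hu : ∃ n, (δ, n) ∈ u.1
  · exact ⟨u, le_rfl, hu⟩
  have hdisj : ∀ᶠ m in Filter.atTop, ∀ p ∈ u.1, lad δ m ∉ range (lad p.1) := by
    refine (Filter.eventually_all_finset u.1).2 fun p hp =>
      hlad.eventually_notMem_range hδ (u.2.1 p hp) fun h => hu ⟨p.2, h ▸ hp⟩
  obtain ⟨n, hn⟩ := Filter.eventually_atTop.1 hdisj
  refine ⟨⟨insert (δ, n) u.1, by simpa [hδ] using u.2.1, ?_⟩, Finset.subset_insert _ _, n,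
    Finset.mem_insert_self _ _⟩
  rw [Finset.coe_insert, pairwise_insert_of_symm]
  exact ⟨u.2.2, fun p hp _ m k hm _ h => absurd ⟨k, h.symm⟩ (hn m hm p hp)⟩

end Condition

theorem MartinsAxiomOmega1.of_small (hMA : MartinsAxiomOmega1.{u}) {P : Type v} [PartialOrder P]
    [Nonempty P] [Small.{u} P] (hP : CCC P) (D : Omega1 → Set P)
    (hD : ∀ ξ p, ∃ q ∈ D ξ, q ≤ p) :
    ∃ G : Set P, DirectedOn (· ≥ ·) G ∧ ∀ ξ, (G ∩ D ξ).Nonempty := by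
  let e : Shrink.{u} P ≃ P := (equivShrink P).symm
  let _ : PartialOrder (Shrink.{u} P) := PartialOrder.lift e e.injective
  have hle {a b : Shrink.{u} P} : a ≤ b ↔ e a ≤ e b := Iff.rfl
  have hccc : CCC (Shrink.{u} P) := fun A hA => by
    refine countable_of_injective_of_countable_image e.injective.injOn (hP (e '' A) ?_)
    rintro _ ⟨p, hp, rfl⟩ _ ⟨q, hq, rfl⟩ hpq ⟨r, hrp, hrq⟩
    exact hA p hp q hq (ne_of_apply_ne e hpq) ⟨e.symm r, by simpa [hle], by simpa [hle]⟩
  have : Nonempty (Shrink.{u} P) := e.nonempty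
  obtain ⟨G, hG⟩ := hMA (Shrink.{u} P) hccc (fun ξ => e ⁻¹' D ξ) fun ξ p => by
    obtain ⟨q, hq, hqp⟩ := hD ξ (e p)
    exact ⟨e.symm q, by simpa using hq, by simpa [hle] using hqp⟩
  refine ⟨e '' {p | p ∈ G}, ?_, fun ξ => ?_⟩
  · rintro _ ⟨p, hp, rfl⟩ _ ⟨q, hq, rfl⟩
    obtain ⟨r, hr, hrp, hrq⟩ := G.directed p hp q hq
    exact ⟨e r, ⟨r, hr, rfl⟩, hrp, hrq⟩
  · obtain ⟨p, hp, hpD⟩ := hG ξ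
    exact ⟨e p, ⟨p, hp, rfl⟩, hpD⟩

theorem MartinsAxiomOmega1.ladderUniformization (hMA : MartinsAxiomOmega1.{u}) :
    LadderUniformization := by
  intro S lad hlad c
  obtain ⟨G, hdir, hG⟩ := hMA.of_small (Condition.ccc (c := c) hlad)
    (fun δ => {u | δ ∈ S → ∃ n, (δ, n) ∈ u.1}) fun δ u => by
      by_cases hδ : δ ∈ S
      · obtain ⟨v, hvu, hv⟩ := Condition.exists_le_mem hlad hδ u
        exact ⟨v, fun _ => hv, hvu⟩
      · exact ⟨u, fun h => absurd h hδ, le_rfl⟩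
  let U : Set (Omega1 × ℕ) := ⋃ u ∈ G, ↑u.1
  have hU : U.Pairwise (Compatible lad c) := by
    intro p hp q hq
    obtain ⟨u, hu, hpu⟩ := mem_iUnion₂.1 hp
    obtain ⟨v, hv, hqv⟩ := mem_iUnion₂.1 hq
    obtain ⟨w, -, hwu, hwv⟩ := hdir u hu v hv
    exact w.2.2 (hwu hpu) (hwv hqv)
  have hUS : ∀ p ∈ U, p.1 ∈ S := fun p hp => by
    obtain ⟨u, -, hpu⟩ := mem_iUnion₂.1 hp
    exact u.2.1 p hpu
  obtain ⟨f, hf⟩ := hlad.exists_uniformizing hUS hU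
  refine ⟨f, fun δ hδ => ?_⟩
  obtain ⟨u, huG, hu⟩ := hG δ
  obtain ⟨n, hn⟩ := hu hδ
  exact Filter.eventually_atTop.2 ⟨n, hf (δ, n) (mem_biUnion huG hn)⟩

/-! ### Threads of a filtration and their jumps -/

section Jump

variable {W : Type*} {z : Omega1 → W} {a ξ η : Omega1}

open Classical in
/-- The least point after `ξ` at which `z` takes another value than at `ξ`; it is `ξ` itself if
there is no such point. -/
noncomputable def nextJump (z : Omega1 → W) (ξ : Omega1) : Omega1 :=
  if h : ∃ η, ξ < η ∧ z η ≠ z ξ then wellFounded_lt.min {η | ξ < η ∧ z η ≠ z ξ} h else ξ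

theorem nextJump_mem (h : ∃ η, ξ < η ∧ z η ≠ z ξ) :
    nextJump z ξ ∈ {η | ξ < η ∧ z η ≠ z ξ} := by
  rw [nextJump, dif_pos h]
  exact wellFounded_lt.min_mem _ h

theorem nextJump_le (h : ξ < η) (hz : z η ≠ z ξ) : nextJump z ξ ≤ η := by
  rw [nextJump, dif_pos ⟨η, h, hz⟩]
  exact wellFounded_lt.min_le (s := {η | ξ < η ∧ z η ≠ z ξ}) ⟨h, hz⟩

theorem apply_nextJump_ne (h : ξ < nextJump z ξ) : z (nextJump z ξ) ≠ z ξ := by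
  by_cases hex : ∃ η, ξ < η ∧ z η ≠ z ξ
  · exact (nextJump_mem hex).2
  · rw [nextJump, dif_neg hex] at h
    exact absurd h (lt_irrefl ξ)

theorem apply_eq_of_lt_nextJump (h : ξ ≤ η) (hη : η < nextJump z ξ) : z η = z ξ := by
  by_contra hz
  exact hη.not_ge (nextJump_le (h.lt_of_ne fun he => hz (congrArg z he.symm)) hz)

/-- The successive jumps of `z`, from `a` on; they are constant after the last one. -/
noncomputable def jump (z : Omega1 → W) (a : Omega1) : ℕ → Omega1
  | 0 => a
  | n + 1 => nextJump z (jump z a n)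

theorem apply_jump_succ_ne (h : StrictMono (jump z a)) (n : ℕ) :
    z (jump z a (n + 1)) ≠ z (jump z a n) :=
  apply_nextJump_ne (h n.lt_succ_self)

theorem strictMono_jump (h : ∀ n, ∃ η, jump z a n < η ∧ z η ≠ z (jump z a n)) :
    StrictMono (jump z a) :=
  strictMono_nat_of_lt_succ fun n => (nextJump_mem (h n)).1

/-- A thread of `N` on `I` picks an element of each `N ξ` with `ξ ∈ I` in such a way that an element
that is picked at some level is also picked at all lower levels where it is available. -/
structure IsThread (N : Omega1 → Set W) (I : Set Omega1) (z : Omega1 → W) : Prop where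
  mem : ∀ ξ ∈ I, z ξ ∈ N ξ
  eq_of_mem : ∀ ξ ∈ I, ∀ η ∈ I, ξ ≤ η → z η ∈ N ξ → z ξ = z η

/- A thread is constant just below each limit, so its jumps do not accumulate there. -/
theorem IsThread.exists_lt_jump {N : Omega1 → Set W} {δ : Omega1} (hz : IsThread N (Ico a δ) z)
    (hN : IsFiltration N) (hjump : StrictMono (jump z a)) : ∀ β < δ, ∃ n, β < jump z a n := by
  intro β hβ
  by_contra! hbound
  obtain ⟨η, hη⟩ := Omega1.exists_isLUB (countable_range (jump z a))
  have hηδ : η < δ := (hη.2 (forall_mem_range.2 hbound)).trans_lt hβ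
  have hlt (n : ℕ) : jump z a n < η := (hjump n.lt_succ_self).trans_le (hη.1 ⟨n + 1, rfl⟩)
  have hmem (n : ℕ) : jump z a n ∈ Ico a δ :=
    ⟨hjump.monotone n.zero_le, (hlt n).trans hηδ⟩
  have hηI : η ∈ Ico a δ := ⟨(hlt 0).le, hηδ⟩
  have hlim : IsSuccLimit η := hη.isSuccLimit_of_notMem (range_nonempty _) <| by
    rintro ⟨n, hn⟩
    exact (hlt n).ne hn
  obtain ⟨b, hb, hzb⟩ := hN.exists_lt hlim (hz.mem η hηI)
  obtain ⟨_, ⟨n, rfl⟩, hn⟩ := (lt_isLUB_iff hη).1 hb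
  have hconst : ∀ m ≥ n, z (jump z a m) = z η := fun m hm =>
    hz.eq_of_mem _ (hmem m) _ hηI (hlt m).le (hN.mono (hn.le.trans (hjump.monotone hm)) hzb)
  exact apply_jump_succ_ne hjump n ((hconst _ n.le_succ).trans (hconst n le_rfl).symm)

end Jump

section ApproximationFromBelow

variable {W : Type*} [LinearOrder W] {A B : Set W} {x y w : W}

theorem isGreatest_inter_Iic_of_subset (hB : IsGreatest (B ∩ Iic x) w) (h : A ⊆ B) (hw : w ∈ A) :
    IsGreatest (A ∩ Iic x) w :=
  ⟨⟨hw, hB.1.2⟩, fun _ hv => hB.2 ⟨h hv.1, hv.2⟩⟩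

theorem lt_of_isGreatest_inter_Iic (hy : IsGreatest (A ∩ Iic y) w) (hw : w ≤ x)
    (hx : ¬ IsGreatest (A ∩ Iic x) w) : y < x := by
  by_contra! h
  exact hx ⟨⟨hy.1.1, hw⟩, fun v hv => hy.2 ⟨hv.1, le_trans hv.2 h⟩⟩

namespace IsFiltration

variable {N : Omega1 → Set W} {z : Omega1 → W} {a δ : Omega1}

theorem isOpen_setOf_isGreatest (hN : IsFiltration N) (x : W) (δ : Omega1) :
    IsOpen {ξ | ξ < δ ∧ ∃ z, IsGreatest (N ξ ∩ Iic x) z} := by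
  rw [SuccOrder.isOpen_iff]
  rintro ξ ⟨hξδ, z, hz⟩ hξ
  obtain ⟨b, hb, hzb⟩ := hN.exists_lt hξ hz.1.1
  exact ⟨b, hb, fun η hη => ⟨hη.2.trans hξδ, z,
    isGreatest_inter_Iic_of_subset hz (hN.mono hη.2.le) (hN.mono hη.1.le hzb)⟩⟩

theorem isThread_of_isGreatest (hN : IsFiltration N) {I : Set Omega1}
    (hz : ∀ ξ ∈ I, IsGreatest (N ξ ∩ Iic y) (z ξ)) : IsThread N I z where
  mem ξ hξ := (hz ξ hξ).1.1
  eq_of_mem ξ hξ η hη h hmem :=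
    (hz ξ hξ).unique (isGreatest_inter_Iic_of_subset (hz η hη) (hN.mono h) hmem)

theorem exists_ne_of_isGreatest (hN : IsFiltration N) (hδ : IsSuccLimit δ)
    (hz : ∀ ξ ∈ Ico a δ, IsGreatest (N ξ ∩ Iic y) (z ξ))
    (hy : ¬ ∃ w, IsGreatest (N δ ∩ Iic y) w) {ξ : Omega1} (hξ : ξ ∈ Ico a δ) :
    ∃ η ∈ Ioo ξ δ, z η ≠ z ξ := by
  by_contra! h
  refine hy ⟨z ξ, ⟨hN.mono hξ.2.le (hz ξ hξ).1.1, (hz ξ hξ).1.2⟩, fun w ⟨hw, hwy⟩ => ?_⟩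
  obtain ⟨η, hη, hwη⟩ := hN.exists_lt hδ hw
  have hζ : succ (max ξ η) ∈ Ioo ξ δ :=
    ⟨(le_max_left ξ η).trans_lt (lt_succ _), hδ.succ_lt (max_lt hξ.2 hη)⟩
  rw [← h _ hζ]
  exact (hz _ ⟨hξ.1.trans hζ.1.le, hζ.2⟩).2
    ⟨hN.mono ((le_max_right ξ η).trans (le_succ _)) hwη, hwy⟩

theorem isLadderSystem_jump (hN : IsFiltration N) {S : Set Omega1} {y : Omega1 → W}
    {z : Omega1 → Omega1 → W} (hS : ∀ δ ∈ S, IsSuccLimit δ ∧ a < δ)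
    (hz : ∀ δ ∈ S, ∀ ξ ∈ Ico a δ, IsGreatest (N ξ ∩ Iic (y δ)) (z δ ξ))
    (hy : ∀ δ ∈ S, ¬ ∃ w, IsGreatest (N δ ∩ Iic (y δ)) w) :
    IsLadderSystem S fun δ => jump (z δ) a := by
  have hchange (δ) (hδ : δ ∈ S) := fun {ξ} =>
    hN.exists_ne_of_isGreatest (ξ := ξ) (hS δ hδ).1 (hz δ hδ) (hy δ hδ)
  have hmem (δ) (hδ : δ ∈ S) (n : ℕ) : jump (z δ) a n ∈ Ico a δ := by
    induction n with
    | zero => exact ⟨le_rfl, (hS δ hδ).2⟩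
    | succ n ih =>
      obtain ⟨η, hη, hne⟩ := hchange δ hδ ih
      exact ⟨ih.1.trans (nextJump_mem ⟨η, hη.1, hne⟩).1.le, (nextJump_le hη.1 hne).trans_lt hη.2⟩
  have hmono (δ) (hδ : δ ∈ S) : StrictMono (jump (z δ) a) := strictMono_jump fun n => by
    obtain ⟨η, hη, hne⟩ := hchange δ hδ (hmem δ hδ n)
    exact ⟨η, hη.1, hne⟩
  exact ⟨fun hδ => hmono _ hδ, fun hδ n => (hmem _ hδ n).2, fun hδ =>
    (hN.isThread_of_isGreatest (hz _ hδ)).exists_lt_jump hN (hmono _ hδ)⟩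

end IsFiltration

end ApproximationFromBelow

/-! ### Finding a Baumgartner type -/

theorem IsLadderSystem.exists_isBaumgartnerType {S : Set Omega1} {lad : Omega1 → ℕ → Omega1}
    (hlad : IsLadderSystem S lad) (hS : IsStationary S) {L : Type*} [LinearOrder L]
    {x : Omega1 → L}
    (hx : ∀ δ ∈ S, ∀ γ ∈ S, toLex (lad δ) < toLex (lad γ) → x γ < x δ) :
    ∃ B : Set (Lex (ℕ → Omega1)), IsBaumgartnerType B ∧ Nonempty ((B : Type 1)ᵒᵈ ↪o L) := by
  refine ⟨(fun δ => toLex (lad δ)) '' S,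
    ⟨S, lad, hS, fun δ hδ => ⟨hlad.strictMono hδ, hlad.lt hδ, hlad.exists_lt hδ⟩, rfl⟩, ?_⟩
  choose g hgS hg using fun b : (fun δ => toLex (lad δ)) '' S => b.2
  refine ⟨OrderEmbedding.ofStrictMono (fun b => x (g (OrderDual.ofDual b))) fun b b' hb => ?_⟩
  have hb : (OrderDual.ofDual b').1 < (OrderDual.ofDual b).1 := hb
  exact hx _ (hgS _) _ (hgS _) ((hg _).trans_lt (hb.trans_eq (hg _).symm))

theorem LadderUniformization.exists_isStationary_coherent (hU : LadderUniformization)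
    {S : Set Omega1} (hS : IsStationary S) {lad : Omega1 → ℕ → Omega1}
    (hlad : IsLadderSystem S lad) (c : Omega1 → ℕ → ℕ) :
    ∃ S' ⊆ S, IsStationary S' ∧
      ∀ δ ∈ S', ∀ γ ∈ S', ∀ j, lad δ j = lad γ j → c δ j = c γ j := by
  obtain ⟨f, hf⟩ := hU S lad hlad c
  obtain ⟨⟨n, s⟩, hS'⟩ := hS.exists_of_countable
    (p := fun δ (v : Σ n : ℕ, Fin n → ℕ) =>
      (∀ j ≥ v.1, f (lad δ j) = c δ j) ∧ ∀ j : Fin v.1, c δ j = v.2 j) fun δ hδ => by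
    obtain ⟨n, hn⟩ := Filter.eventually_atTop.1 (hf δ hδ)
    exact ⟨⟨n, fun j => c δ j⟩, hn, fun j => rfl⟩
  refine ⟨_, sep_subset _ _, hS', fun δ hδ γ hγ j hj => ?_⟩
  rcases le_or_gt n j with hnj | hjn
  · rw [← hδ.2.1 j hnj, ← hγ.2.1 j hnj, hj]
  · exact (hδ.2.2 ⟨j, hjn⟩).trans (hγ.2.2 ⟨j, hjn⟩).symm

section Core

variable {W : Type*} [LinearOrder W] {N : Omega1 → Set W}

/- The first difference between two ladders of jumps comes right after a common rung, at which the
two threads agree by coherence of the colouring. The thread that jumps first does so because the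
common value is no longer the best lower approximation to its target. -/
theorem lt_of_toLex_jump_lt {a δ γ : Omega1} {x y : W} {z z' : Omega1 → W}
    (hz : ∀ ξ ∈ Ico a δ, IsGreatest (N ξ ∩ Iic x) (z ξ))
    (hz' : ∀ ξ ∈ Ico a γ, IsGreatest (N ξ ∩ Iic y) (z' ξ))
    (hmono : StrictMono (jump z a)) (hlt : ∀ n, jump z a n < δ) (hlt' : ∀ n, jump z' a n < γ)
    (heq : ∀ j, jump z a j = jump z' a j → z (jump z a j) = z' (jump z a j))
    (h : toLex (jump z a) < toLex (jump z' a)) : y < x := by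
  obtain ⟨k, hk, hkk⟩ := h
  obtain ⟨j, rfl⟩ : ∃ j, k = j + 1 := Nat.exists_eq_succ_of_ne_zero fun h0 => by
    subst h0
    exact lt_irrefl a hkk
  replace hk : jump z a j = jump z' a j := hk j j.lt_succ_self
  replace hkk : jump z a (j + 1) < jump z' a (j + 1) := hkk
  have hmem (n : ℕ) : jump z a n ∈ Ico a δ := ⟨hmono.monotone n.zero_le, hlt n⟩
  have hstay : z' (jump z a (j + 1)) = z (jump z a j) := by
    rw [heq j hk, hk]
    exact apply_eq_of_lt_nextJump (hk ▸ (hmono j.lt_succ_self).le) hkk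
  have hy := hz' (jump z a (j + 1)) ⟨(hmem _).1, hkk.trans (hlt' _)⟩
  rw [hstay] at hy
  exact lt_of_isGreatest_inter_Iic hy (hz _ (hmem j)).1.2 fun hx =>
    apply_jump_succ_ne hmono j ((hz _ (hmem (j + 1))).unique hx)

variable {S : Set Omega1} {L : Type*} [LinearOrder L] (i : L ↪o W) {x : Omega1 → L} {a : Omega1}

theorem LadderUniformization.exists_isBaumgartnerType (hU : LadderUniformization)
    (hN : IsFiltration N) (hS : IsStationary S)
    (hx : ∀ δ ∈ S, ∀ ξ ∈ Ioo a δ, ∃ z, IsGreatest (N ξ ∩ Iic (i (x δ))) z)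
    (hx' : ∀ δ ∈ S, ¬ ∃ z, IsGreatest (N δ ∩ Iic (i (x δ))) z) :
    ∃ B : Set (Lex (ℕ → Omega1)), IsBaumgartnerType B ∧ Nonempty ((B : Type 1)ᵒᵈ ↪o L) := by
  obtain ⟨a', ha'⟩ := exists_gt a
  let S₁ := S ∩ {δ | IsSuccLimit δ} ∩ Ioi a'
  have hS₁ : IsStationary S₁ := (hS.inter_isClub isClub_isSuccLimit).inter_isClub (isClub_Ioi a')
  have : Nonempty W := ⟨i (x a)⟩
  choose! z hz using hx
  replace hz : ∀ δ ∈ S₁, ∀ ξ ∈ Ico a' δ, IsGreatest (N ξ ∩ Iic (i (x δ))) (z δ ξ) :=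
    fun δ hδ ξ hξ => hz δ hδ.1.1 ξ ⟨ha'.trans_le hξ.1, hξ.2⟩
  choose e he using fun ξ => countable_iff_exists_injOn.1 (hN.countable ξ)
  have hlad : IsLadderSystem S₁ fun δ => jump (z δ) a' :=
    hN.isLadderSystem_jump (fun δ hδ => ⟨hδ.1.2, hδ.2⟩) hz fun δ hδ => hx' δ hδ.1.1
  obtain ⟨S', hS', hstat, hcoh⟩ := hU.exists_isStationary_coherent hS₁ hlad fun δ n =>
    e (jump (z δ) a' n) (z δ (jump (z δ) a' n))
  have hlad' : IsLadderSystem S' fun δ => jump (z δ) a' :=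
    ⟨fun h => hlad.strictMono (hS' h), fun h => hlad.lt (hS' h), fun h => hlad.exists_lt (hS' h)⟩
  refine hlad'.exists_isBaumgartnerType hstat fun δ hδ γ hγ => i.lt_iff_lt.1 ∘
    lt_of_toLex_jump_lt (hz δ (hS' hδ)) (hz γ (hS' hγ))
      (hlad'.strictMono hδ) (hlad'.lt hδ) (hlad'.lt hγ) fun j hj => ?_
  have hmem (ε) (hε : ε ∈ S') := (hz ε (hS' hε) _
    ⟨(hlad'.strictMono hε).monotone j.zero_le, hlad'.lt hε j⟩).1.1
  exact he _ (hmem δ hδ) (hj ▸ hmem γ hγ) (by simpa only [hj] using hcoh δ hδ γ hγ j hj)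

theorem LadderUniformization.exists_isBaumgartnerType_of_isGreatest (hU : LadderUniformization)
    (hN : IsFiltration N) (hS : IsStationary S) {E : Set Omega1} (hE : IsClub E)
    (hx : ∀ δ ∈ S, ∀ ξ ∈ E ∩ Ioo a δ, ∃ z, IsGreatest (N ξ ∩ Iic (i (x δ))) z)
    (hx' : ∀ δ ∈ S, ¬ ∃ z, IsGreatest (N δ ∩ Iic (i (x δ))) z) :
    ∃ B : Set (Lex (ℕ → Omega1)), IsBaumgartnerType B ∧ Nonempty ((B : Type 1)ᵒᵈ ↪o L) := by
  refine hU.exists_isBaumgartnerType i (hN.comp_next hE) (hS.inter_isClub hE.derivedSet)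
    (x := x) (a := a) (fun δ hδ ξ hξ => ?_) fun δ hδ => ?_
  · obtain ⟨b, hb, hξb, hbδ⟩ := (SuccOrder.accPt_principal.1 hδ.2).2 ξ hξ.2
    exact hx δ hδ.1 _ ⟨hE.next_mem ξ, hξ.1.trans_le (hE.le_next ξ),
      (hE.next_le hb (le_of_lt hξb)).trans_lt hbδ⟩
  · simpa only [hE.next_eq (hE.derivedSet_subset hδ.2)] using hx' δ hδ.1

theorem LadderUniformization.exists_isBaumgartnerType_of_isLeast (hU : LadderUniformization)
    (hN : IsFiltration N) (hS : IsStationary S) {E : Set Omega1} (hE : IsClub E)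
    (hx : ∀ δ ∈ S, ∀ ξ ∈ E ∩ Ioo a δ, ∃ z, IsLeast (N ξ ∩ Ici (i (x δ))) z)
    (hx' : ∀ δ ∈ S, ¬ ∃ z, IsLeast (N δ ∩ Ici (i (x δ))) z) :
    ∃ B : Set (Lex (ℕ → Omega1)), IsBaumgartnerType B ∧ Nonempty (B ↪o L) := by
  obtain ⟨B, hB, ⟨f⟩⟩ := hU.exists_isBaumgartnerType_of_isGreatest i.dual
    (hN.preimage OrderDual.ofDual.injective) hS hE (x := fun δ => OrderDual.toDual (x δ)) hx hx'
  exact ⟨B, hB, ⟨f.dual⟩⟩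

end Core

/-! ### A criterion for being `σ`-scattered -/

section Neighbour

variable {W : Type*} [LinearOrder W] {A B : Set W} {x y w v : W}

/-- `w` is an immediate neighbour of `x` in `A`: no other point of `A` lies between `w` and `x`.
It may be `x` itself. -/
def IsNeighbour (A : Set W) (x w : W) : Prop :=
  IsGreatest (A ∩ Iic x) w ∨ IsLeast (A ∩ Ici x) w

/-- `A` has a point between any two of its points that some point of the whole order separates. -/
def IsGapless (A : Set W) : Prop :=
  ∀ z ∈ A, ∀ z' ∈ A, (Ioo z z').Nonempty → (A ∩ Ioo z z').Nonempty

namespace IsNeighbour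

theorem mem (h : IsNeighbour A x w) : w ∈ A :=
  h.elim (fun h => h.1.1) fun h => h.1.1

theorem self (h : x ∈ A) : IsNeighbour A x x :=
  .inl ⟨⟨h, le_rfl⟩, fun _ hw => hw.2⟩

theorem isGreatest (h : IsNeighbour A x w) (hw : w ≤ x) : IsGreatest (A ∩ Iic x) w :=
  h.elim id fun h => ⟨⟨h.1.1, hw⟩, fun _ hv => hv.2.trans h.1.2⟩

theorem isLeast (h : IsNeighbour A x w) (hw : x ≤ w) : IsLeast (A ∩ Ici x) w :=
  h.elim (fun h => ⟨⟨h.1.1, hw⟩, fun _ hv => le_trans h.1.2 hv.2⟩) id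

theorem of_subset (h : IsNeighbour B x w) (hA : A ⊆ B) (hw : w ∈ A) : IsNeighbour A x w :=
  h.imp (fun h => ⟨⟨hw, h.1.2⟩, fun _ hv => h.2 ⟨hA hv.1, hv.2⟩⟩)
    fun h => ⟨⟨hw, h.1.2⟩, fun _ hv => h.2 ⟨hA hv.1, hv.2⟩⟩

theorem lt_of_le (hy : IsNeighbour A y w) (hwy : w ≤ y) (hwx : w ≤ x)
    (hx : ¬ IsNeighbour A x w) : y < x :=
  lt_of_isGreatest_inter_Iic (hy.isGreatest hwy) hwx fun h => hx (.inl h)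

theorem lt_of_ge (hy : IsNeighbour A y w) (hyw : y ≤ w) (hxw : x ≤ w)
    (hx : ¬ IsNeighbour A x w) : x < y := by
  by_contra! h
  exact hx (.inr ⟨⟨hy.mem, hxw⟩, fun v hv => (hy.isLeast hyw).2 ⟨hv.1, h.trans hv.2⟩⟩)

end IsNeighbour

namespace IsGapless

theorem eq_of_isGreatest_of_isLeast (hA : IsGapless A) (hw : IsGreatest (A ∩ Iic x) w)
    (hv : IsLeast (A ∩ Ici x) v) : w = v := by
  rcases eq_or_lt_of_le (show w ≤ x from hw.1.2) with rfl | hwx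
  · exact le_antisymm hv.1.2 (hv.2 ⟨hw.1.1, le_rfl⟩)
  rcases eq_or_lt_of_le (show x ≤ v from hv.1.2) with rfl | hxv
  · exact le_antisymm hwx.le (hw.2 ⟨hv.1.1, le_rfl⟩)
  obtain ⟨u, hu, hwu, huv⟩ := hA w hw.1.1 v hv.1.1 ⟨x, hwx, hxv⟩
  rcases le_total u x with hux | hxu
  · exact absurd (hw.2 ⟨hu, hux⟩) hwu.not_ge
  · exact absurd (hv.2 ⟨hu, hxu⟩) huv.not_ge

theorem isNeighbour_unique (hA : IsGapless A) (hw : IsNeighbour A x w) (hv : IsNeighbour A x v) :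
    w = v := by
  rcases hw with hw | hw <;> rcases hv with hv | hv
  · exact hw.unique hv
  · exact hA.eq_of_isGreatest_of_isLeast hw hv
  · exact (hA.eq_of_isGreatest_of_isLeast hv hw).symm
  · exact hw.unique hv

variable {N : Omega1 → Set W} {z : Omega1 → W}

theorem isThread_of_isNeighbour (hgap : ∀ ξ, IsGapless (N ξ)) (hN : Monotone N)
    (hz : ∀ ξ, IsNeighbour (N ξ) x (z ξ)) (I : Set Omega1) : IsThread N I z where
  mem ξ _ := (hz ξ).mem
  eq_of_mem ξ _ η _ h hmem := (hgap ξ).isNeighbour_unique (hz ξ) ((hz η).of_subset (hN h) hmem)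

theorem jump_lt_jump_succ (hgap : ∀ ξ, IsGapless (N ξ)) (hN : Monotone N)
    (hz : ∀ ξ, IsNeighbour (N ξ) x (z ξ)) {ξ : Omega1} (hx : x ∈ N ξ) {a : Omega1} {n : ℕ}
    (hne : z (jump z a n) ≠ x) : jump z a n < jump z a (n + 1) := by
  obtain ⟨η, hη⟩ := exists_gt (max ξ (jump z a n))
  have hzη : z η = x := (hgap η).isNeighbour_unique (hz η)
    (.self (hN ((le_max_left _ _).trans hη.le) hx))
  exact (nextJump_mem ⟨η, (le_max_right _ _).trans_lt hη, hzη ▸ hne.symm⟩).1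

theorem exists_apply_jump_eq (hgap : ∀ ξ, IsGapless (N ξ)) (hN : IsFiltration N)
    (hz : ∀ ξ, IsNeighbour (N ξ) x (z ξ)) {ξ : Omega1} (hx : x ∈ N ξ) (a : Omega1) :
    ∃ n, z (jump z a n) = x := by
  by_contra! hne
  have hmono : StrictMono (jump z a) :=
    strictMono_nat_of_lt_succ fun n => jump_lt_jump_succ hgap hN.mono hz hx (hne n)
  obtain ⟨β, hβ⟩ := Omega1.exists_forall_lt (countable_range (jump z a))
  obtain ⟨n, hn⟩ := (isThread_of_isNeighbour hgap hN.mono hz _).exists_lt_jump hN hmono β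
    (lt_succ β)
  exact (hβ _ ⟨n, rfl⟩).not_gt hn

end IsGapless

end Neighbour

theorem exists_Ioo_eq_of_antitoneOn {α β : Type*} [LinearOrder α] [DenselyOrdered α]
    [LinearOrder β] [WellFoundedLT β] {φ : α → β} {a b : α} (hab : a < b)
    (hφ : AntitoneOn φ (Ioo a b)) :
    ∃ a' b', a' < b' ∧ Ioo a' b' ⊆ Ioo a b ∧ ∃ v, ∀ q ∈ Ioo a' b', φ q = v := by
  obtain ⟨q₀, hq₀, hmin⟩ := exists_minimalFor_of_wellFoundedLT (· ∈ Ioo a b) φ (exists_between hab)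
  refine ⟨q₀, b, hq₀.2, Ioo_subset_Ioo_left hq₀.1.le, φ q₀, fun q hq => ?_⟩
  have hq' : q ∈ Ioo a b := ⟨hq₀.1.trans hq.1, hq.2⟩
  have hle : φ q ≤ φ q₀ := hφ hq₀ hq' hq.1.le
  exact hle.antisymm (hmin hq' hle)

theorem exists_Ioo_eq_of_monotoneOn {α β : Type*} [LinearOrder α] [DenselyOrdered α]
    [LinearOrder β] [WellFoundedLT β] {φ : α → β} {a b : α} (hab : a < b)
    (hφ : MonotoneOn φ (Ioo a b)) :
    ∃ a' b', a' < b' ∧ Ioo a' b' ⊆ Ioo a b ∧ ∃ v, ∀ q ∈ Ioo a' b', φ q = v := by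
  obtain ⟨b', a', hlt, hsub, v, hv⟩ := exists_Ioo_eq_of_antitoneOn
    (φ := φ ∘ OrderDual.ofDual) (OrderDual.toDual_lt_toDual.2 hab)
    fun p hp q hq h => hφ ⟨hq.2, hq.1⟩ ⟨hp.2, hp.1⟩ h
  exact ⟨a', b', hlt, fun q hq => (hsub ⟨hq.2, hq.1⟩).symm, v, fun q hq => hv _ ⟨hq.2, hq.1⟩⟩

theorem isSigmaScattered_of_countable {L X : Type*} [LinearOrder L] [Countable X] [Nonempty X]
    {s : X → Set L} (hs : ∀ v, IsScattered (s v)) (hcover : ∀ x, ∃ v, x ∈ s v) :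
    IsSigmaScattered L := by
  obtain ⟨e, he⟩ := exists_surjective_nat X
  refine ⟨s ∘ e, eq_univ_of_forall fun x => ?_, fun n => hs (e n)⟩
  obtain ⟨v, hv⟩ := hcover x
  obtain ⟨n, rfl⟩ := he v
  exact mem_iUnion.2 ⟨n, hv⟩

section Scattered

variable {W : Type*} [LinearOrder W] {N : Omega1 → Set W} {L : Type*} [LinearOrder L] {i : L ↪o W}
  {z : L → Omega1 → W} {a : Omega1} {n : ℕ} {s : Set L}

/-- Let `z x ξ` be the neighbour of `x` at level `ξ`. The points of a monochromatic set are reached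
after the same number `n` of jumps, all of them have the same position relative to their neighbours
on the way, and the place of a jump determines the neighbour found there. -/
structure IsMonochromatic (i : L ↪o W) (z : L → Omega1 → W) (a : Omega1) (n : ℕ) (s : Set L) :
    Prop where
  apply_jump : ∀ x ∈ s, z x (jump (z x) a n) = i x
  jump_lt : ∀ x ∈ s, ∀ j < n, jump (z x) a j < jump (z x) a (j + 1)
  eq_of_jump_eq : ∀ x ∈ s, ∀ y ∈ s, ∀ j ≤ n, jump (z x) a j = jump (z y) a j →
    z x (jump (z x) a j) = z y (jump (z y) a j)
  same_side : ∀ j < n, (∀ x ∈ s, z x (jump (z x) a j) ≤ i x) ∨ ∀ x ∈ s, i x ≤ z x (jump (z x) a j)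

namespace IsMonochromatic

theorem isNeighbour_and_not_isNeighbour (hs : IsMonochromatic i z a n s)
    (hgap : ∀ ξ, IsGapless (N ξ)) (hz : ∀ x ξ, IsNeighbour (N ξ) (i x) (z x ξ)) {x y : L}
    (hx : x ∈ s) (hy : y ∈ s) {j : ℕ} (hj : j < n) (heq : jump (z x) a j = jump (z y) a j)
    (hlt : jump (z x) a (j + 1) < jump (z y) a (j + 1)) :
    IsNeighbour (N (jump (z x) a (j + 1))) (i y) (z x (jump (z x) a j)) ∧
      ¬ IsNeighbour (N (jump (z x) a (j + 1))) (i x) (z x (jump (z x) a j)) := by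
  have hjump := hs.jump_lt x hx j hj
  constructor
  · have hstay : z y (jump (z x) a (j + 1)) = z x (jump (z x) a j) := by
      rw [hs.eq_of_jump_eq x hx y hy j hj.le heq]
      exact apply_eq_of_lt_nextJump (heq ▸ hjump.le) hlt
    exact hstay ▸ hz y _
  · exact fun h => apply_nextJump_ne hjump ((hgap _).isNeighbour_unique (hz x _) h)

/- If two points have the same jumps up to `j`, the one with the earlier jump `j + 1` is farther
away from their common neighbour. Along a set that is dense in itself, the place of this jump is
hence monotone or antitone as long as the previous one is constant, and so it is constant on an
interval. -/
theorem exists_Ioo_jump_eq (hs : IsMonochromatic i z a n s) (hgap : ∀ ξ, IsGapless (N ξ))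
    (hz : ∀ x ξ, IsNeighbour (N ξ) (i x) (z x ξ)) (f : ℚ ↪o s) {j : ℕ} (hj : j ≤ n) :
    ∃ b c : ℚ, b < c ∧ ∃ v, ∀ q ∈ Ioo b c, jump (z (f q)) a j = v := by
  induction j with
  | zero => exact ⟨0, 1, one_pos, a, fun _ _ => rfl⟩
  | succ j ih =>
    obtain ⟨b, c, hbc, v, hv⟩ := ih (Nat.le_of_succ_le hj)
    have heq {p q : ℚ} (hp : p ∈ Ioo b c) (hq : q ∈ Ioo b c) :=
      (hv p hp).trans (hv q hq).symm
    have hw {p q : ℚ} (hp : p ∈ Ioo b c) (hq : q ∈ Ioo b c) :=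
      hs.eq_of_jump_eq _ (f p).2 _ (f q).2 j (Nat.le_of_succ_le hj) (heq hp hq)
    have hstep {p q : ℚ} (hp : p ∈ Ioo b c) (hq : q ∈ Ioo b c) :=
      hs.isNeighbour_and_not_isNeighbour hgap hz (f p).2 (f q).2 hj (heq hp hq)
    have hconst : ∃ b' c', b' < c' ∧ Ioo b' c' ⊆ Ioo b c ∧
        ∃ v, ∀ q ∈ Ioo b' c', jump (z (f q)) a (j + 1) = v := by
      rcases hs.same_side j hj with hside | hside
      · refine exists_Ioo_eq_of_antitoneOn hbc fun p hp q hq hpq => not_lt.1 fun hlt => ?_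
        obtain ⟨hnb, hnot⟩ := hstep hp hq hlt
        have hlt := hnb.lt_of_le (hw hp hq ▸ hside _ (f q).2) (hside _ (f p).2) hnot
        exact hpq.not_gt (f.lt_iff_lt.1 (i.lt_iff_lt.1 hlt))
      · refine exists_Ioo_eq_of_monotoneOn hbc fun p hp q hq hpq => not_lt.1 fun hlt => ?_
        obtain ⟨hnb, hnot⟩ := hstep hq hp hlt
        have hlt := hnb.lt_of_ge (hw hq hp ▸ hside _ (f p).2) (hside _ (f q).2) hnot
        exact hpq.not_gt (f.lt_iff_lt.1 (i.lt_iff_lt.1 hlt))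
    obtain ⟨b', c', hbc', -, hv'⟩ := hconst
    exact ⟨b', c', hbc', hv'⟩

theorem isScattered (hs : IsMonochromatic i z a n s) (hgap : ∀ ξ, IsGapless (N ξ))
    (hz : ∀ x ξ, IsNeighbour (N ξ) (i x) (z x ξ)) : IsScattered s := by
  refine ⟨fun f => ?_⟩
  obtain ⟨b, c, hbc, v, hv⟩ := hs.exists_Ioo_jump_eq hgap hz f le_rfl
  obtain ⟨p, hp⟩ := exists_between hbc
  obtain ⟨q, hq⟩ := exists_between hp.2
  have hq' : q ∈ Ioo b c := ⟨hp.1.trans hq.1, hq.2⟩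
  have heq := hs.eq_of_jump_eq _ (f p).2 _ (f q).2 n le_rfl ((hv p hp).trans (hv q hq').symm)
  rw [hs.apply_jump _ (f p).2, hs.apply_jump _ (f q).2] at heq
  exact hq.1.ne (f.injective (Subtype.ext (i.injective heq)))

end IsMonochromatic

theorem isSigmaScattered_of_isNeighbour (i : L ↪o W) (hN : IsFiltration N)
    (hgap : ∀ ξ, IsGapless (N ξ)) (hmem : ∀ x, ∃ ξ, i x ∈ N ξ)
    (hnb : ∀ x ξ, ∃ w, IsNeighbour (N ξ) (i x) w) : IsSigmaScattered L := by
  classical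
  choose z hz using hnb
  choose e he using fun ξ => countable_iff_exists_injOn.1 (hN.countable ξ)
  obtain ⟨a⟩ := (inferInstance : Nonempty Omega1)
  have hreach (x : L) : ∃ n, z x (jump (z x) a n) = i x :=
    IsGapless.exists_apply_jump_eq hgap hN (hz x) (hmem x).choose_spec a
  let colour (x : L) (j : ℕ) : ℕ × Prop :=
    (e (jump (z x) a j) (z x (jump (z x) a j)), z x (jump (z x) a j) ≤ i x)
  let s (v : Σ n : ℕ, Fin (n + 1) → ℕ × Prop) : Set L :=
    {x | IsLeast {n | z x (jump (z x) a n) = i x} v.1 ∧ ∀ j : Fin (v.1 + 1), colour x j = v.2 j}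
  have hs (v) : IsMonochromatic i z a v.1 (s v) := by
    have hcolour {x y} (hx : x ∈ s v) (hy : y ∈ s v) {j : ℕ} (hj : j ≤ v.1) :
        colour x j = colour y j :=
      (hx.2 ⟨j, Nat.lt_succ_of_le hj⟩).trans (hy.2 ⟨j, Nat.lt_succ_of_le hj⟩).symm
    refine ⟨fun x hx => hx.1.1, fun x hx j hj => ?_, fun x hx y hy j hj heq => ?_, fun j hj => ?_⟩
    · exact IsGapless.jump_lt_jump_succ hgap hN.mono (hz x) (hmem x).choose_spec
        fun h => hj.not_ge (hx.1.2 h)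
    · have hcol : e _ _ = e _ _ := congrArg Prod.fst (hcolour hx hy hj)
      rw [← heq] at hcol ⊢
      exact he _ (hz x _).mem (hz y _).mem hcol
    · by_cases hleft : (v.2 ⟨j, Nat.lt_succ_of_lt hj⟩).2
      · exact .inl fun x hx => (congrArg Prod.snd (hx.2 ⟨j, Nat.lt_succ_of_lt hj⟩)).mpr hleft
      · exact .inr fun x hx => le_of_not_ge fun h =>
          hleft ((congrArg Prod.snd (hx.2 ⟨j, Nat.lt_succ_of_lt hj⟩)).mp h)
  refine isSigmaScattered_of_countable (fun v => (hs v).isScattered hgap hz) fun x => ?_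
  exact ⟨⟨Nat.find (hreach x), fun j => colour x j⟩,
    ⟨Nat.find_spec (hreach x), fun n hn => Nat.find_min' _ hn⟩, fun _ => rfl⟩

end Scattered

/-! ### Filtrations by sets that contain witnesses -/

section Filtration

open FirstOrder Language

variable {X : Type*} {T : Omega1 → Set X → Set X}

/-- The chain of substructures in which each member is generated by its predecessors `A` together
with the sets `T η A`, where `η` is the index of `A`. -/
def substructureChain (F : Language) [F.Structure X] (T : Omega1 → Set X → Set X) (ξ : Omega1) :
    F.Substructure X :=
  Substructure.closure F (⋃ η : Iio ξ, (substructureChain F T η ∪ T η (substructureChain F T η)))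
termination_by wellFounded_lt.wrap ξ
decreasing_by all_goals exact η.2

variable {F : Language} [F.Structure X] {ξ η : Omega1}

theorem subset_substructureChain (h : η < ξ) :
    (substructureChain F T η : Set X) ∪ T η (substructureChain F T η) ⊆
      substructureChain F T ξ := by
  conv_rhs => rw [substructureChain]
  exact fun w hw => Substructure.subset_closure (mem_iUnion_of_mem (⟨η, h⟩ : Iio ξ) hw)

theorem substructureChain_mono : Monotone (substructureChain F T) := fun _ _ h =>
  h.eq_or_lt.elim (fun h => h ▸ le_rfl) fun h =>
    subset_union_left.trans (subset_substructureChain h)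

theorem countable_substructureChain [Countable (Σ n, F.Functions n)]
    (hT : ∀ ξ A, A.Countable → (T ξ A).Countable) (ξ : Omega1) :
    (substructureChain F T ξ : Set X).Countable := by
  induction ξ using WellFoundedLT.induction with
  | _ ξ ih =>
    have : Countable (Iio ξ) := (Omega1.countable_Iio ξ).to_subtype
    rw [substructureChain]
    exact (countable_iUnion fun η : Iio ξ =>
      (ih η η.2).union (hT _ _ (ih η η.2))).substructure_closure F

theorem isFiltration_substructureChain [Countable (Σ n, F.Functions n)]
    (hT : ∀ ξ A, A.Countable → (T ξ A).Countable) :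
    IsFiltration fun ξ => (substructureChain F T ξ : Set X) where
  mono _ _ h := substructureChain_mono h
  countable := countable_substructureChain hT
  exists_lt := by
    intro ξ hξ w hw
    have : Nonempty (Iio ξ) := hξ.nonempty_Iio.to_subtype
    have hdir : Directed (· ≤ ·) fun η : Iio ξ => substructureChain F T η :=
      (substructureChain_mono.comp (Subtype.mono_coe _)).directed_le
    suffices hle : substructureChain F T ξ ≤ ⨆ η : Iio ξ, substructureChain F T η by
      obtain ⟨η, hη⟩ := (Substructure.mem_iSup_of_directed hdir).1 (hle hw)
      exact ⟨η, η.2, hη⟩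
    rw [substructureChain, Substructure.closure_le]
    refine iUnion_subset fun η => (subset_substructureChain (lt_succ η.1)).trans ?_
    exact SetLike.coe_subset_coe.2
      (le_iSup (fun η : Iio ξ => substructureChain F T η) ⟨succ η.1, hξ.succ_lt η.2⟩)

/-- `A` contains a witness for each relation `R r` and each tuple of parameters in `A`, provided
that there is a witness at all. -/
def ContainsWitnesses {I : ℕ → Type*} (R : ∀ {n}, I n → (Fin n → X) → X → Prop) (A : Set X) :
    Prop :=
  ∀ {n} (r : I n) (v : Fin n → X), (∀ j, v j ∈ A) → (∃ a, R r v a) → ∃ a ∈ A, R r v a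

theorem exists_isFiltration_containsWitnesses [Nonempty X] {I : ℕ → Type*} [Countable (Σ n, I n)]
    (R : ∀ {n}, I n → (Fin n → X) → X → Prop) (hT : ∀ ξ A, A.Countable → (T ξ A).Countable) :
    ∃ N, IsFiltration N ∧ (∀ ξ, ContainsWitnesses R (N ξ)) ∧ ∀ η ξ, η < ξ → T η (N η) ⊆ N ξ := by
  let F : Language := ⟨I, fun _ => Empty⟩
  let _ : F.Structure X := ⟨fun r v => Classical.epsilon (R r v), fun r => r.elim⟩
  have : Countable (Σ n, F.Functions n) := ‹Countable (Σ n, I n)›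
  exact ⟨fun ξ => substructureChain F T ξ, isFiltration_substructureChain hT,
    fun ξ _ r v hv h => ⟨_, (substructureChain F T ξ).fun_mem r v hv, Classical.epsilon_spec h⟩,
    fun η ξ h => subset_union_right.trans (subset_substructureChain h)⟩

end Filtration

/-! ### The completion as a linear order -/

section Cut

variable {L : Type u} [LinearOrder L]

/-- The completion of `L`, ordered by inclusion. -/
def Cut (L : Type u) [LinearOrder L] : Type u := {A : Set L // IsCut A}

namespace Cut

variable {A B : Cut L} {x : L}

instance : PartialOrder (Cut L) := inferInstanceAs (PartialOrder {A : Set L // IsCut A})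

noncomputable instance : LinearOrder (Cut L) where
  le_total A B := IsLowerSet.total A.2.1 B.2.1
  toDecidableLE := Classical.decRel _

/-- The embedding of `L` into its completion. -/
def point : L ↪o Cut L :=
  OrderEmbedding.ofStrictMono (fun x => ⟨Iio x, isLowerSet_Iio x, .inl ⟨x, rfl⟩⟩)
    fun _ _ h => Iio_ssubset_Iio h

theorem point_lt_of_mem (h : x ∈ A.1) : point x < A :=
  ⟨fun _ hy => A.2.1 (le_of_lt hy) h, fun h' => lt_irrefl x (h' h)⟩

theorem le_point_of_notMem (h : x ∉ A.1) : A ≤ point x :=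
  fun _ hy => lt_of_not_ge fun h' => h (A.2.1 h' hy)

theorem exists_point_lt (h : A < B) (hB : B ∉ range point) : ∃ x, point x ∈ Ioo A B := by
  obtain ⟨y, hyB, hyA⟩ := exists_of_ssubset h
  have hmax := B.2.2.resolve_left fun ⟨x, hx⟩ => hB ⟨x, Subtype.ext hx.symm⟩
  obtain ⟨y', hy', hyy'⟩ := hmax y hyB
  exact ⟨y', (le_point_of_notMem hyA).trans_lt (point.lt_iff_lt.2 hyy'), point_lt_of_mem hy'⟩

theorem exists_lt_point (h : A < B) (hA : A ∉ range point) : ∃ x, point x ∈ Ioo A B := by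
  obtain ⟨y, hyB, hyA⟩ := exists_of_ssubset h
  exact ⟨y, (le_point_of_notMem hyA).lt_of_ne fun h => hA ⟨y, h.symm⟩, point_lt_of_mem hyB⟩

theorem exists_point_mem_Ioo (h : (Ioo A B).Nonempty) : ∃ x, point x ∈ Ioo A B := by
  obtain ⟨D, hAD, hDB⟩ := h
  by_cases hD : D ∈ range point
  · obtain ⟨x, rfl⟩ := hD
    exact ⟨x, hAD, hDB⟩
  · obtain ⟨x, hx⟩ := exists_point_lt hAD hD
    exact ⟨x, hx.1, hx.2.trans hDB⟩

/-- `N` has a point of `L` between any two of its cuts that some cut separates. -/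
def IsPointGapless (N : Set (Cut L)) : Prop :=
  ∀ A ∈ N, ∀ B ∈ N, (Ioo A B).Nonempty → ∃ x, point x ∈ N ∩ Ioo A B

namespace IsPointGapless

variable {N : Set (Cut L)}

theorem isGapless (hN : IsPointGapless N) : IsGapless N := fun A hA B hB h =>
  let ⟨_, hx⟩ := hN A hA B hB h
  ⟨_, hx⟩

theorem exists_point_mem_Ioc (hN : IsPointGapless N) (hA : A ∈ N) (hB : B ∈ N) (h : A < B) :
    ∃ y, point y ∈ N ∩ Ioc A B := by
  by_cases hBp : B ∈ range point
  · obtain ⟨y, rfl⟩ := hBp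
    exact ⟨y, hB, h, le_rfl⟩
  · obtain ⟨x, hx⟩ := exists_point_lt h hBp
    obtain ⟨y, hy, hyAB⟩ := hN A hA B hB ⟨_, hx⟩
    exact ⟨y, hy, Ioo_subset_Ioc_self hyAB⟩

theorem exists_point_mem_Ico (hN : IsPointGapless N) (hA : A ∈ N) (hB : B ∈ N) (h : A < B) :
    ∃ y, point y ∈ N ∩ Ico A B := by
  by_cases hAp : A ∈ range point
  · obtain ⟨y, rfl⟩ := hAp
    exact ⟨y, hA, le_rfl, h⟩
  · obtain ⟨x, hx⟩ := exists_lt_point h hAp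
    obtain ⟨y, hy, hyAB⟩ := hN A hA B hB ⟨_, hx⟩
    exact ⟨y, hy, Ioo_subset_Ico_self hyAB⟩

theorem exists_isNeighbour (hN : IsPointGapless N) (hA : A ∈ N)
    (h : ∀ y, point y ∈ N → point y ∉ Ioo A (point x) ∧ point y ∉ Ioo (point x) A) :
    ∃ w, IsNeighbour N (point x) w := by
  by_cases hx : point x ∈ N
  · exact ⟨_, .self hx⟩
  refine ⟨A, (le_total A (point x)).imp (fun hAx => ⟨⟨hA, hAx⟩, fun B hB => ?_⟩)
    fun hxA => ⟨⟨hA, hxA⟩, fun B hB => ?_⟩⟩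
  · by_contra! hAB
    obtain ⟨y, hyN, hAy, hyB⟩ := hN.exists_point_mem_Ioc hA hB.1 hAB
    exact (h y hyN).1 ⟨hAy, (hyB.trans hB.2).lt_of_ne fun heq => hx (heq ▸ hyN)⟩
  · by_contra! hBA
    obtain ⟨y, hyN, hBy, hyA⟩ := hN.exists_point_mem_Ico hB.1 hA hBA
    exact (h y hyN).2 ⟨(hB.2.trans hBy).lt_of_ne fun heq => hx (heq ▸ hyN), hyA⟩

end IsPointGapless

end Cut

end Cut

/-! ### Clubs of countable sets -/

section CountableSets

variable {X E Z : ZFSet.{u}} {K : Set ZFSet.{u}}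

theorem card_eq_aleph0_iff :
    Z.card = ℵ₀ ↔ (Z : Set ZFSet.{u}).Countable ∧ (Z : Set ZFSet.{u}).Infinite := by
  rw [← Cardinal.lift_inj.{u, u + 1}, ← ZFSet.cardinalMk_coe_sort, Cardinal.lift_aleph0,
    le_antisymm_iff]
  exact and_congr Cardinal.le_aleph0_iff_set_countable
    (Cardinal.aleph0_le_mk_iff.trans infinite_coe_iff)

/-- A surjection from `ℕ` onto the countably infinite set `Z`; junk for other sets. -/
noncomputable def enumerate (Z : ZFSet.{u}) : ℕ → ZFSet.{u} :=
  Classical.epsilon fun e => (Z : Set ZFSet.{u}) = range e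

theorem coe_eq_range_enumerate (h : Z.card = ℵ₀) : (Z : Set ZFSet.{u}) = range (enumerate Z) :=
  Classical.epsilon_spec <|
    (card_eq_aleph0_iff.1 h).1.exists_eq_range (card_eq_aleph0_iff.1 h).2.nonempty

theorem IsClubCountable.exists_superset (hE : IsClubCountable X E)
    (hX : (X : Set ZFSet.{u}).Infinite) (hZX : Z ⊆ X) (hZ : (Z : Set ZFSet.{u}).Countable) :
    ∃ W ∈ E, Z ⊆ W := by
  let s : ℕ → ZFSet.{u} := fun n => hX.natEmbedding _ n
  have hs : Function.Injective s := Subtype.val_injective.comp (hX.natEmbedding _).injective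
  obtain ⟨W, hWE, hW⟩ := hE.2.1 (Z ∪ ZFSet.range s)
    (fun z hz => (ZFSet.mem_union.1 hz).elim (fun hz => hZX hz) fun hz => by
      obtain ⟨n, rfl⟩ := ZFSet.mem_range.1 hz
      exact (hX.natEmbedding _ n).2)
    (by
      rw [card_eq_aleph0_iff, ZFSet.coe_union, ZFSet.coe_range]
      exact ⟨hZ.union (countable_range s),
        (infinite_range_of_injective hs).mono subset_union_right⟩)
  exact ⟨W, hWE, fun z hz => hW (ZFSet.mem_union.2 (.inl hz))⟩

/- The trace of `K` on `X` is the union of a sequence of members of `E ∩ K` that absorbs its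
elements one by one. -/
theorem IsClubCountable.sep_mem (hE : IsClubCountable X E) (hK : K.Countable)
    (hne : ∃ Z ∈ E, Z ∈ K) (hsub : ∀ Z ∈ E, Z ∈ K → ∀ z ∈ Z, z ∈ K)
    (hext : ∀ Z ∈ E, Z ∈ K → ∀ z ∈ X, z ∈ K → ∃ W ∈ E, W ∈ K ∧ Z ⊆ W ∧ z ∈ W) :
    X.sep (· ∈ K) ∈ E := by
  obtain ⟨Z₀, hZ₀E, hZ₀K⟩ := hne
  obtain ⟨z₀, hz₀⟩ := (card_eq_aleph0_iff.1 (hE.1 Z₀ hZ₀E).2).2.nonempty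
  obtain ⟨y, hy⟩ := (hK.mono inter_subset_right).exists_eq_range
    (⟨z₀, (hE.1 Z₀ hZ₀E).1 hz₀, hsub Z₀ hZ₀E hZ₀K z₀ hz₀⟩ : ((X : Set ZFSet.{u}) ∩ K).Nonempty)
  have hyXK (n : ℕ) : y n ∈ (X : Set ZFSet.{u}) ∩ K := hy ▸ mem_range_self n
  have hext' (Z : {Z // Z ∈ E ∧ Z ∈ K}) (n : ℕ) :
      ∃ W : {W // W ∈ E ∧ W ∈ K}, Z.1 ⊆ W.1 ∧ y n ∈ W.1 := by
    obtain ⟨W, hWE, hWK, hW⟩ := hext Z Z.2.1 Z.2.2 (y n) (hyXK n).1 (hyXK n).2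
    exact ⟨⟨W, hWE, hWK⟩, hW⟩
  choose grow hZgrow hygrow using hext'
  let f (n : ℕ) : {Z // Z ∈ E ∧ Z ∈ K} := n.rec ⟨Z₀, hZ₀E, hZ₀K⟩ fun n Z => grow Z n
  suffices heq : X.sep (· ∈ K) = ZFSet.iUnion fun n => (f n).1 by
    rw [heq]
    exact hE.2.2 _ (fun n => (f n).2.1) fun n => hZgrow (f n) n
  ext z
  rw [ZFSet.mem_sep, ZFSet.mem_iUnion]
  refine ⟨fun hz => ?_, fun ⟨n, hn⟩ =>
    ⟨(hE.1 _ (f n).2.1).1 hn, hsub _ (f n).2.1 (f n).2.2 z hn⟩⟩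
  obtain ⟨n, rfl⟩ := hy.subset hz
  exact ⟨n + 1, hygrow (f n) n⟩

end CountableSets

/-! ### Countable models -/

section Models

open FirstOrder Language

theorem H.mem_of_mem {θ : Cardinal.{u}} {x y : ZFSet.{u}} (hx : x ∈ H θ) (h : y ∈ x) : y ∈ H θ := by
  obtain ⟨t, ht, hxt, hc⟩ := hx
  exact ⟨t, ht, ht.subset_of_mem (hxt h), hc⟩

variable {L : Type u} (c : L ↪ ZFSet.{u})

/-- The structure `H(θ_L)`. -/
abbrev HTheta : Type (u + 1) := H (theta (carrierSet c))

theorem code_injective : Function.Injective (code c) := fun A B h => by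
  ext x
  simpa [code] using ZFSet.ext_iff.1 h (c x)

theorem code_subset (A : Set L) : code c A ⊆ carrierSet c := fun z hz => by
  obtain ⟨x, rfl⟩ := ZFSet.mem_range.1 hz
  exact ZFSet.mem_range_self _

theorem carrierSet_mem_H : carrierSet c ∈ H (theta (carrierSet c)) :=
  (theta_spec (carrierSet c)).2 0

instance : Nonempty (HTheta c) := ⟨⟨_, carrierSet_mem_H c⟩⟩

theorem code_mem_H (A : Set L) : code c A ∈ H (theta (carrierSet c)) :=
  H.mem_of_mem ((theta_spec _).2 1) (ZFSet.mem_powerset.2 (code_subset c A))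

variable [LinearOrder L]

theorem mem_completionSet {z : ZFSet.{u}} : z ∈ completionSet c ↔ ∃ A : Cut L, code c A.1 = z := by
  rw [completionSet, ZFSet.mem_sep, ZFSet.mem_powerset]
  constructor
  · rintro ⟨-, A, hA, rfl⟩
    exact ⟨⟨A, hA⟩, rfl⟩
  · rintro ⟨A, rfl⟩
    exact ⟨code_subset c _, A.1, A.2, rfl⟩

theorem infinite_completionSet [Infinite L] : (completionSet c : Set ZFSet.{u}).Infinite :=
  infinite_of_injective_forall_mem
    ((code_injective c).comp (Subtype.val_injective.comp (Cut.point (L := L)).injective))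
    fun x => (mem_completionSet c).2 ⟨Cut.point x, rfl⟩

theorem mem_H_of_subset_completionSet {Z : ZFSet.{u}} (h : Z ⊆ completionSet c) :
    Z ∈ H (theta (carrierSet c)) :=
  H.mem_of_mem ((theta_spec _).2 2) (ZFSet.mem_powerset.2 fun _ hz => (ZFSet.mem_sep.1 (h hz)).1)

theorem orderSet_mem_H : orderSet c ∈ H (theta (carrierSet c)) := by
  suffices h : orderSet c ∈ (carrierSet c).powerset.powerset.powerset from
    H.mem_of_mem ((theta_spec _).2 3) h
  refine ZFSet.mem_powerset.2 fun z hz => ?_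
  obtain ⟨p, rfl⟩ := ZFSet.mem_range.1 hz
  refine ZFSet.mem_powerset.2 fun w hw => ZFSet.mem_powerset.2 fun v hv => ?_
  have hvp : v = c p.1.1 ∨ v = c p.1.2 := by
    rcases ZFSet.mem_pair.1 hw with rfl | rfl
    · exact .inl (ZFSet.mem_singleton.1 hv)
    · exact ZFSet.mem_pair.1 hv
  rcases hvp with rfl | rfl <;> exact ZFSet.mem_range_self _

/-- The trace of `M` on the completion of `L`. -/
noncomputable def trace (M : Set ZFSet.{u}) : ZFSet.{u} := (completionSet c).sep (· ∈ M)

/-- The cuts of `L` that belong to `M`. -/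
def cutsIn (M : Set ZFSet.{u}) : Set (Cut L) := {A | code c A.1 ∈ M}

instance (n : ℕ) : Countable (setLanguage.Functions n) := inferInstanceAs (Countable Empty)

instance (n : ℕ) : Subsingleton (setLanguage.Relations n) :=
  ⟨fun r s => by cases r; cases s; rfl⟩

instance : Countable setLanguage.Symbols :=
  inferInstanceAs (Countable ((Σ n, setLanguage.Functions n) ⊕ Σ n, setLanguage.Relations n))

instance (n : ℕ) : Countable (setLanguage.BoundedFormula Empty n) :=
  (sigma_mk_injective (β := setLanguage.BoundedFormula Empty) (i := n)).countable

/-- The names of the relations for which the models to be constructed contain witnesses, listed by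
their number of parameters; see `WitnessRel`. -/
inductive Requirement : ℕ → Type
  | formula {n : ℕ} (φ : setLanguage.BoundedFormula Empty (n + 1)) : Requirement n
  | carrier : Requirement 0
  | order : Requirement 0
  | element (k : ℕ) : Requirement 1
  | mem : Requirement 1
  | between : Requirement 2
  | extension : Requirement 3

instance (n : ℕ) : Countable (Requirement n) := by
  let f : Requirement n → setLanguage.BoundedFormula Empty (n + 1) ⊕ ℕ ⊕ Fin 5
    | .formula φ => .inl φ
    | .carrier => .inr (.inr 0)
    | .order => .inr (.inr 1)
    | .element k => .inr (.inl k)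
    | .mem => .inr (.inr 2)
    | .between => .inr (.inr 3)
    | .extension => .inr (.inr 4)
  have hf : Function.Injective f := by
    intro r s h
    cases r <;> cases s <;> simp_all [f]
  exact hf.countable

/-- `WitnessRel c r v a` says that `a` is a witness for the requirement `r` with parameters `v`.
Witnesses for the formulas yield elementarity, by the Tarski–Vaught test. What the
other requirements are for would follow from elementarity, too, but only after formalizing it. -/
def WitnessRel : ∀ {n}, Requirement n → (Fin n → HTheta c) → HTheta c → Prop
  | _, .formula φ, v, a => φ.Realize default (Fin.snoc v a : _ → HTheta c)
  | _, .carrier, _, a => a.1 = carrierSet c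
  | _, .order, _, a => a.1 = orderSet c
  | _, .element k, v, a => a.1 = enumerate (v 0).1 k
  | _, .mem, v, a => a.1 ∈ (v 0).1
  | _, .between, v, a => ∃ (A B : Cut L) (x : L), (v 0).1 = code c A.1 ∧ (v 1).1 = code c B.1 ∧
      a.1 = code c (Cut.point x).1 ∧ Cut.point x ∈ Ioo A B
  | _, .extension, v, a => a.1 ∈ (v 0).1 ∧ (v 1).1 ⊆ a.1 ∧ (v 2).1 ∈ a.1

section ContainsWitnesses

variable {c} {A : Set (HTheta c)}

theorem mem_elementarySubmodels (hA : ContainsWitnesses (WitnessRel c) A) (hcount : A.Countable) :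
    Subtype.val '' A ∈ elementarySubmodels c := by
  refine ⟨hcount.image _, ?_, ?_, ?_⟩
  · let S : setLanguage.Substructure (HTheta c) := ⟨A, fun f => f.elim⟩
    refine ⟨S.toElementarySubstructure fun n φ v a ha => ?_, rfl⟩
    obtain ⟨b, hb, hφ⟩ := hA (.formula φ) (fun j => (v j).1) (fun j => (v j).2) ⟨a, ha⟩
    exact ⟨⟨b, hb⟩, hφ⟩
  · obtain ⟨a, ha, h⟩ := hA .carrier finZeroElim nofun ⟨⟨_, carrierSet_mem_H c⟩, rfl⟩
    exact ⟨a, ha, h⟩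
  · obtain ⟨a, ha, h⟩ := hA .order finZeroElim nofun ⟨⟨_, orderSet_mem_H c⟩, rfl⟩
    exact ⟨a, ha, h⟩

theorem isPointGapless_cutsIn (hA : ContainsWitnesses (WitnessRel c) A) :
    Cut.IsPointGapless (cutsIn c (Subtype.val '' A)) := by
  rintro B ⟨b, hb, hbB⟩ D ⟨d, hd, hdD⟩ hBD
  obtain ⟨x, hx⟩ := Cut.exists_point_mem_Ioo hBD
  obtain ⟨a, ha, B', D', y, hB', hD', hay, hy⟩ := hA .between ![b, d]
    (Fin.forall_fin_two.2 ⟨hb, hd⟩) ⟨⟨_, code_mem_H c _⟩, B, D, x, hbB, hdD, rfl, hx⟩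
  obtain rfl : B = B' := Subtype.ext (code_injective c (hbB.symm.trans hB'))
  obtain rfl : D = D' := Subtype.ext (code_injective c (hdD.symm.trans hD'))
  exact ⟨y, ⟨a, ha, hay⟩, hy⟩

theorem mem_of_mem_of_card (hA : ContainsWitnesses (WitnessRel c) A) {Z z : ZFSet.{u}}
    (hZ : Z.card = ℵ₀) (hZA : Z ∈ Subtype.val '' A) (hz : z ∈ Z) : z ∈ Subtype.val '' A := by
  obtain ⟨Z, hZA, rfl⟩ := hZA
  obtain ⟨k, rfl⟩ := (coe_eq_range_enumerate hZ).subset hz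
  obtain ⟨a, ha, h⟩ := hA (.element k) ![Z] (fun _ => by simpa using hZA)
    ⟨⟨_, H.mem_of_mem Z.2 hz⟩, rfl⟩
  exact ⟨a, ha, h⟩

theorem trace_mem_club [Infinite L] (hA : ContainsWitnesses (WitnessRel c) A)
    (hcount : A.Countable) {E : ZFSet.{u}} (hE : IsClubCountable (completionSet c) E)
    (hEA : E ∈ Subtype.val '' A) : trace c (Subtype.val '' A) ∈ E := by
  obtain ⟨E, hEA, rfl⟩ := hEA
  refine hE.sep_mem (hcount.image _) ?_
    (fun Z hZE hZA z hz => mem_of_mem_of_card hA (hE.1 Z hZE).2 hZA hz) ?_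
  · obtain ⟨W, hW, -⟩ := hE.exists_superset (infinite_completionSet c) (ZFSet.empty_subset _)
      (by simp)
    obtain ⟨a, ha, h⟩ := hA .mem ![E] (fun _ => by simpa using hEA) ⟨⟨W, H.mem_of_mem E.2 hW⟩, hW⟩
    exact ⟨a, h, a, ha, rfl⟩
  · rintro _ hZE ⟨Z, hZA, rfl⟩ _ hz ⟨z, hzA, rfl⟩
    obtain ⟨W, hW, hsub⟩ := hE.exists_superset (Z := insert z.1 Z.1) (infinite_completionSet c)
      (fun w hw => (ZFSet.mem_insert_iff.1 hw).elim (fun h => h ▸ hz) fun h => (hE.1 _ hZE).1 h)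
      (by simpa using (card_eq_aleph0_iff.1 (hE.1 _ hZE).2).1)
    obtain ⟨a, ha, haE, hZa, hza⟩ := hA .extension ![E, Z, z]
      (fun j => by fin_cases j <;> assumption)
      ⟨⟨W, H.mem_of_mem E.2 hW⟩, hW, fun w hw => hsub (ZFSet.mem_insert_of_mem _ hw),
        hsub (ZFSet.mem_insert _ _)⟩
    exact ⟨a, haE, ⟨a, ha, rfl⟩, hZa, hza⟩

end ContainsWitnesses

/-- A filtration by countable elementary submodels of `H(θ_L)` that covers the points of `L`. -/
structure IsModelChain (M : Omega1 → Set ZFSet.{u}) : Prop where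
  isFiltration : IsFiltration M
  mem_elementarySubmodels : ∀ ξ, M ξ ∈ elementarySubmodels c
  trace_mem : ∀ η ξ, η < ξ → trace c (M η) ∈ M ξ
  trace_mem_club : ∀ ξ, ∀ E ∈ M ξ, IsClubCountable (completionSet c) E → trace c (M ξ) ∈ E
  isPointGapless : ∀ ξ, Cut.IsPointGapless (cutsIn c (M ξ))
  exists_point_mem : ∀ x, ∃ ξ, Cut.point x ∈ cutsIn c (M ξ)

theorem exists_isModelChain (hcard : #L = ℵ₁) : ∃ M, IsModelChain c M := by
  have : Infinite L := Cardinal.aleph0_le_mk_iff.1 (hcard ▸ Cardinal.aleph0_le_aleph 1)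
  obtain ⟨e⟩ : Nonempty (Omega1 ≃ L) := by
    rw [← Cardinal.lift_mk_eq'.{1, u}, hcard]
    simp [Cardinal.mk_Iio_ordinal]
  let T (ξ : Omega1) (A : Set (HTheta c)) : Set (HTheta c) :=
    {⟨trace c (Subtype.val '' A), mem_H_of_subset_completionSet c ZFSet.sep_subset⟩,
      ⟨code c (Cut.point (e ξ)).1, code_mem_H c _⟩}
  obtain ⟨N, hN, hwit, hT⟩ := exists_isFiltration_containsWitnesses (WitnessRel c) (T := T)
    fun ξ A _ => (toFinite _).countable
  refine ⟨fun ξ => Subtype.val '' N ξ, hN.image _,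
    fun ξ => mem_elementarySubmodels (hwit ξ) (hN.countable ξ),
    fun η ξ h => ⟨_, hT η ξ h (.inl rfl), rfl⟩,
    fun ξ E hEM hE => trace_mem_club (hwit ξ) (hN.countable ξ) hE hEM,
    fun ξ => isPointGapless_cutsIn (hwit ξ), fun x => ?_⟩
  refine ⟨succ (e.symm x), _, hT _ _ (lt_succ (e.symm x)) (.inr rfl), ?_⟩
  simp only [Equiv.apply_symm_apply]

namespace IsModelChain

variable {c} {M : Omega1 → Set ZFSet.{u}}

theorem isFiltration_cutsIn (hM : IsModelChain c M) : IsFiltration fun ξ => cutsIn c (M ξ) :=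
  hM.isFiltration.preimage ((code_injective c).comp Subtype.val_injective)

theorem isStationary (hM : IsModelChain c M) (hL : ¬ IsSigmaScattered L) :
    IsStationary {δ | ∃ x, ¬ ∃ w, IsNeighbour (cutsIn c (M δ)) (Cut.point x) w} := by
  intro D hD
  by_contra hempty
  refine hL (isSigmaScattered_of_isNeighbour Cut.point (hM.isFiltration_cutsIn.comp_next hD)
    (fun ξ => (hM.isPointGapless _).isGapless) (fun x => ?_) fun x ξ => ?_)
  · obtain ⟨ξ, hξ⟩ := hM.exists_point_mem x
    exact ⟨ξ, hM.isFiltration_cutsIn.mono (hD.le_next ξ) hξ⟩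
  · by_contra hx
    exact hempty ⟨hD.next ξ, ⟨x, hx⟩, hD.next_mem ξ⟩

theorem exists_isNeighbour_of_captures (hM : IsModelChain c M) {x : L} {ξ : Omega1}
    (h : Captures c (trace c (M ξ)) x) :
    ∃ w, IsNeighbour (cutsIn c (M ξ)) (Cut.point x) w := by
  obtain ⟨A, hA, hAM, hbetween⟩ := h
  refine (hM.isPointGapless ξ).exists_isNeighbour (A := ⟨A, hA⟩) (ZFSet.mem_sep.1 hAM).2
    fun y hyM => ?_
  obtain ⟨hleft, hright⟩ :=
    hbetween y (ZFSet.mem_sep.2 ⟨(mem_completionSet c).2 ⟨Cut.point y, rfl⟩, hyM⟩)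
  exact ⟨fun h => hleft ⟨h.1, Cut.point.lt_iff_lt.1 h.2⟩,
    fun h => hright ⟨Cut.point.lt_iff_lt.1 h.1, h.2⟩⟩

/- The traces of the models that contain the club provided by amenability belong to this club. -/
theorem exists_forall_isNeighbour (hM : IsModelChain c M) (hc : IsAmenableVia c) {δ : Omega1}
    (hδ : IsSuccLimit δ) (x : L) :
    ∃ a < δ, ∀ ξ ∈ Ico a δ, ∃ w, IsNeighbour (cutsIn c (M ξ)) (Cut.point x) w := by
  obtain ⟨E, hEM, hE, hcap⟩ := hc _ (hM.mem_elementarySubmodels δ) x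
  obtain ⟨a, ha, hEa⟩ := hM.isFiltration.exists_lt hδ hEM
  refine ⟨a, ha, fun ξ hξ => hM.exists_isNeighbour_of_captures (hcap _ ?_ ?_)⟩
  · exact hM.trace_mem_club ξ E (hM.isFiltration.mono hξ.1 hEa) hE
  · exact hM.trace_mem ξ δ hξ.2

end IsModelChain

end Models

end LinearOrderBasis

open LinearOrderBasis Set Order in
theorem theorem3p1_general (hU : LadderUniformization) (hDagger : Dagger) (L : Type u)
    [LinearOrder L] (hcard : Cardinal.mk L = Cardinal.aleph 1) (hL : ¬ IsSigmaScattered L)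
    (hamenable : IsAmenable L) :
    ∃ B : Set (Lex (ℕ → Omega1)),
      IsBaumgartnerType B ∧ (Nonempty (B ↪o L) ∨ Nonempty ((B : Type 1)ᵒᵈ ↪o L)) := by
  obtain ⟨c, hc⟩ := hamenable
  obtain ⟨M, hM⟩ := exists_isModelChain c hcard
  let N (ξ : Omega1) : Set (Cut L) := cutsIn c (M ξ)
  have hN : IsFiltration N := hM.isFiltration_cutsIn
  have hS := (hM.isStationary hL).inter_isClub isClub_isSuccLimit
  have : Nonempty L := Cardinal.mk_ne_zero_iff.1 (hcard ▸ (Cardinal.aleph_pos 1).ne')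
  choose! x hx using fun (δ : Omega1) (hδ : ∃ x, ¬ ∃ w, IsNeighbour (N δ) (Cut.point x) w) => hδ
  obtain ⟨a, hSa⟩ := hS.exists_bound fun δ hδ => hM.exists_forall_isNeighbour hc hδ.2 (x δ)
  obtain ⟨E, hE, b, hS' | hS'⟩ := hDagger.exists_dichotomy hSa
    (fun δ => {ξ | ξ < δ ∧ ∃ z, IsGreatest (N ξ ∩ Iic (Cut.point (x δ))) z})
    fun δ _ => ⟨fun ξ hξ => hξ.1, hN.isOpen_setOf_isGreatest _ δ⟩
  · obtain ⟨B, hB, hBL⟩ := hU.exists_isBaumgartnerType_of_isGreatest Cut.point hN hS' hE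
      (fun δ hδ ξ hξ => (hδ.2 hξ).2)
      fun δ hδ ⟨z, hz⟩ => hx δ hδ.1.1.1 ⟨z, .inl hz⟩
    exact ⟨B, hB, .inr hBL⟩
  · obtain ⟨B, hB, hBL⟩ := hU.exists_isBaumgartnerType_of_isLeast Cut.point hN hS' hE
      (a := max a b)
      (fun δ hδ ξ ⟨hξE, hξ, hξδ⟩ =>
        (hδ.1.2 ξ ⟨(max_lt_iff.1 hξ).1.le, hξδ⟩).imp fun z hz => hz.resolve_left fun hz =>
          disjoint_left.1 hδ.2 ⟨hξE, (max_lt_iff.1 hξ).2, hξδ⟩ ⟨hξδ, z, hz⟩)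
      fun δ hδ ⟨z, hz⟩ => hx δ hδ.1.1.1 ⟨z, .inr hz⟩
    exact ⟨B, hB, .inl hBL⟩

/-- Under Martin's axiom for `ℵ₁` dense sets and `(†)`, every amenable non `σ`-scattered linear order
of size `ℵ₁` contains a copy of a Baumgartner type or of the reverse of one. -/
theorem theorem3p1
    (hMA : LinearOrderBasis.MartinsAxiomOmega1.{u})
    (hDagger : LinearOrderBasis.Dagger)
    (L : Type u) [LinearOrder L]
    (hcard : Cardinal.mk L = Cardinal.aleph 1)
    (hL : ¬ LinearOrderBasis.IsSigmaScattered L)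
    (hamenable : LinearOrderBasis.IsAmenable L) :
    ∃ B : Set (Lex (ℕ → LinearOrderBasis.Omega1)),
      LinearOrderBasis.IsBaumgartnerType B ∧
        (Nonempty (B ↪o L) ∨ Nonempty ((B : Type 1)ᵒᵈ ↪o L)) :=
  theorem3p1_general hMA.ladderUniformization hDagger L hcard hL hamenable
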